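/- Let $0<\lambda<\mu$ and $\delta>0$, let $\mathbb{N}=\{0,1,2,\dots\}$, and let $\{X(t)\}_{t\ge 0}$ be the customer count, scaled by $\delta$, of the $M/M/1$ system with arrival rate $\lambda$ and service rate $\mu$: the continuous-time Markov chain on $\delta\mathbb{N}$ with generator $$G_Xf(\delta k)=\lambda\,\Delta f(\delta k)-\mu\,1(k>0)\,\Delta f(\delta(k-1)),\qquad k\in\mathbb{N},$$ where $\Delta f(\delta k)=f(\delta(k+1))-f(\delta k)$, and $\Delta^{a}$ is the $a$-fold iterate of $\Delta$. Let $X$ have the stationary distribution of this chain and write $\mathbb{E}_{\delta k}$ for expectation given $X(0)=\delta k$. For $h:\delta\mathbb{N}\to\mathbb{R}$ put $$f_h(\delta k)=\int_0^\infty\big(\mathbb{E}_{\delta k}h(X(t))-\mathbb{E}h(X)\big)\,dt,\qquad k\in\mathbb{N},$$ where $\int_0^\infty$ means $\lim_{T\to\infty}\int_0^T$. Let $\mathrm{dLip}(1)$ be the set of $h:\delta\mathbb{N}\to\mathbb{R}$ with $|\Delta h(\delta k)|\le\delta$ for all $k\in\mathbb{N}$. **Proposition.** 1. Let $h\in\mathrm{dLip}(1)$.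 Then $\mathbb{E}|h(X)|<\infty$, $\mathbb{E}_{\delta k}|h(X(t))|<\infty$ for all $t\ge0$ and $k\in\mathbb{N}$, the integral defining $f_h(\delta k)$ converges absolutely for every $k\in\mathbb{N}$, and $$\int_0^\infty\big|\mathbb{E}_{\delta(k+1)}h(X(t))-\mathbb{E}_{\delta k}h(X(t))\big|\,dt\le\frac{\delta(k+1)}{\mu-\lambda},\qquad k\in\mathbb{N}.$$ 2. Let $a\in\{1,2,3\}$, and suppose that $|\Delta^{v}h(\delta k)|\le\delta^{v}$ for all $1\le v\le a$ and all $k\in\mathbb{N}$. Then $$|\Delta^{a}f_h(\delta k)|\le\frac{\delta^{a}(k+1)}{\mu-\lambda}+\delta^{a-1}\frac{1}{\mu-\lambda},\qquad k\in\mathbb{N}.$$ 3. For every $h:\delta\mathbb{N}\to\mathbb{R}$ for which $f_h$ is well defined, that is, $\mathbb{E}|h(X)|<\infty$ and $\lim_{T\to\infty}\int_0^T(\mathbb{E}_{\delta k}h(X(t))-\mathbb{E}h(X))\,dt$ exists in $\mathbb{R}$ for all $k\in\mathbb{N}$, $$\Delta^{2}f_h(0)-\Delta f_h(0)=\frac{\lambda+\mu}{\mu}\,\Delta^{3}f_h(0)-\frac1\mu\,\Delta^{3}h(0)-\frac{\lambda}{\mu}\,\Delta^{3}f_h(\delta).$$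 -/

import Mathlib

open MeasureTheory ProbabilityTheory Filter Topology Set
open scoped NNReal fwdDiff

/-- The `M/M/1` generator with arrival rate `lam` and service rate `mu`, acting on functions of the
customer count: `G f (k) = lam * Δ f (k) - mu * 1(k > 0) * Δ f (k - 1)`. -/
noncomputable def mm1Gen (lam mu : ℝ) (f : ℕ → ℝ) (k : ℕ) : ℝ :=
  lam * (f (k + 1) - f k) - if 0 < k then mu * (f k - f (k - 1)) else 0

/-- `N` is, under the probability measure `P`, the customer count of an `M/M/1` system: a
right-continuous `ℕ`-valued process that solves the martingale problem of the generator `mm1Gen`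
(a bounded operator, whose domain is the space of bounded functions on `ℕ`). -/
structure IsMM1Process {Ω : Type*} [MeasurableSpace Ω] (lam mu : ℝ) (P : Measure Ω)
    (N : ℝ≥0 → Ω → ℕ) : Prop where
  stronglyMeasurable : ∀ t, StronglyMeasurable (N t)
  rightContinuous : ∀ ω t, ContinuousWithinAt (fun s => N s ω) (Ici t) t
  martingale : ∀ f : ℕ → ℝ, (∃ C : ℝ, ∀ k, |f k| ≤ C) →
    Martingale
      (fun (t : ℝ≥0) ω => f (N t ω) - ∫ s in (0 : ℝ)..t, mm1Gen lam mu f (N s.toNNReal ω))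
      (Filtration.natural N stronglyMeasurable) P

/-- The `M/M/1` Markov chain as a family of laws: under `P k` the customer count `N` is an `M/M/1`
process that starts from `k` customers. -/
structure IsMM1Family {Ω : Type*} [MeasurableSpace Ω] (lam mu : ℝ) (P : ℕ → Measure Ω)
    (N : ℝ≥0 → Ω → ℕ) : Prop where
  isProbabilityMeasure : ∀ k, IsProbabilityMeasure (P k)
  isMM1Process : ∀ k, IsMM1Process lam mu (P k) N
  start : ∀ k, ∀ᵐ ω ∂(P k), N 0 ω = k

/-- `π` is a stationary distribution: if the initial customer count has law `π`, then so has the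
customer count at every later time. -/
structure IsStationaryLaw {Ω : Type*} [MeasurableSpace Ω] (P : ℕ → Measure Ω)
    (N : ℝ≥0 → Ω → ℕ) (π : Measure ℕ) : Prop where
  isProbabilityMeasure : IsProbabilityMeasure π
  invariant : ∀ (t : ℝ≥0) (A : Set ℕ), ∫⁻ k, P k {ω | N t ω ∈ A} ∂π = π A

/-- `E_{δ k} h(X(t))`, where `X(t) = δ N(t)` is the scaled customer count started from `δ k`;
the real number `t` is meant to be nonnegative. -/
noncomputable def expAt {Ω : Type*} [MeasurableSpace Ω] (δ : ℝ) (P : ℕ → Measure Ω)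
    (N : ℝ≥0 → Ω → ℕ) (h : ℝ → ℝ) (k : ℕ) (t : ℝ) : ℝ :=
  ∫ ω, h (δ * (N t.toNNReal ω : ℝ)) ∂(P k)

/-- `E h(X)`, where `X` is `δ` times a customer count with law `π`. -/
noncomputable def statExp (δ : ℝ) (π : Measure ℕ) (h : ℝ → ℝ) : ℝ :=
  ∫ j, h (δ * (j : ℝ)) ∂π

/-- The value `∫_0^T (E_{δ k} h(X(t)) - E h(X)) dt`. -/
noncomputable def partialSol {Ω : Type*} [MeasurableSpace Ω] (δ : ℝ) (P : ℕ → Measure Ω)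
    (N : ℝ≥0 → Ω → ℕ) (π : Measure ℕ) (h : ℝ → ℝ) (k : ℕ) (T : ℝ) : ℝ :=
  ∫ t in (0 : ℝ)..T, (expAt δ P N h k t - statExp δ π h)

/-- `f_h(δ k) = ∫_0^∞ (E_{δ k} h(X(t)) - E h(X)) dt`, as a function of `k`. The integral is the
limit of the integrals over `[0, T]`; it is the Lebesgue integral over `(0, ∞)` whenever the
integrand is Lebesgue integrable there. -/
noncomputable def poissonSol {Ω : Type*} [MeasurableSpace Ω] (δ : ℝ) (P : ℕ → Measure Ω)
    (N : ℝ≥0 → Ω → ℕ) (π : Measure ℕ) (h : ℝ → ℝ) (k : ℕ) : ℝ :=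
  limUnder atTop (partialSol δ P N π h k)

/-- The class `dLip(1)` on the grid `δ ℕ`. Only the values of `h` on `δ ℕ` matter. -/
def DLip (δ : ℝ) (h : ℝ → ℝ) : Prop :=
  ∀ k : ℕ, |Δ_[δ] h (δ * (k : ℝ))| ≤ δ

/-! ### The generator as a bounded operator -/

/-! The argument is analytic and uses no coupling. The generator is bounded on bounded functions, so
the martingale problem forces the transition semigroup to be its exponential
(`clm_eq_comp_exp_of_forward`), which yields the backward equation. Balance across cuts makes the
stationary law geometric. Its atoms are all positive, so stationary integrability controls means
from every starting state, and truncation extends the backward equation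
(`IsStationaryLaw.meanAt_backward`).

For Lipschitz `g`, the spatial differences of `E_k g(N_t)` solve the backward equation of the walk
killed at the origin. Hence the time integrals of their absolute values form a subsolution of a
linear difference inequality, and comparison with a linear function gives the bound of part 1
(`le_of_subsolution`). Averaging over the stationary law gives absolute convergence of the integral
defining `f_h`.

Applying the generator to the integrals over `[0, T]` and letting `T → ∞` gives the Poisson
equation, a first-order recursion for `Δ f_h`. Its differences satisfy `mu * e k = lam * e (k + 1) +
b k`; as `lam < mu`, a solution of linear growth is bounded by `sup |b| / (mu - lam)`
(`abs_le_of_linear_recursion`). This gives orders two and three, while order one follows from part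
1. The identity at zero is linear algebra on the same recursion and the boundary equation. -/

lemma abs_mm1Gen_le {lam mu : ℝ} (hlam : 0 ≤ lam) (hmu : 0 ≤ mu) {f : ℕ → ℝ} {C : ℝ}
    (hf : ∀ k, |f k| ≤ C) (k : ℕ) : |mm1Gen lam mu f k| ≤ 2 * (lam + mu) * C := by
  have hC : 0 ≤ C := (abs_nonneg _).trans (hf 0)
  have key : ∀ i j, |f i - f j| ≤ 2 * C := fun i j =>
    (abs_sub _ _).trans (by linarith [hf i, hf j])
  have h1 : |lam * (f (k + 1) - f k)| ≤ lam * (2 * C) := by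
    rw [abs_mul, abs_of_nonneg hlam]; gcongr; exact key _ _
  have h2 : |if 0 < k then mu * (f k - f (k - 1)) else 0| ≤ mu * (2 * C) := by
    split_ifs
    · rw [abs_mul, abs_of_nonneg hmu]; gcongr; exact key _ _
    · rw [abs_zero]; positivity
  rw [mm1Gen]
  exact (abs_sub _ _).trans (by linarith)

/-- The generator as a bounded linear operator on the bounded functions. -/
noncomputable def mm1GenCLM (lam mu : ℝ) (hlam : 0 ≤ lam) (hmu : 0 ≤ mu) :
    BoundedContinuousFunction ℕ ℝ →L[ℝ] BoundedContinuousFunction ℕ ℝ :=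
  LinearMap.mkContinuous
    { toFun := fun f => BoundedContinuousFunction.ofNormedAddCommGroupDiscrete (mm1Gen lam mu f)
        (2 * (lam + mu) * ‖f‖) (abs_mm1Gen_le hlam hmu fun k => f.norm_coe_le_norm k)
      map_add' := fun f g => by
        ext k
        simp only [BoundedContinuousFunction.coe_ofNormedAddCommGroupDiscrete, mm1Gen,
          BoundedContinuousFunction.coe_add, Pi.add_apply]
        split_ifs <;> ring
      map_smul' := fun c f => by
        ext k
        simp only [BoundedContinuousFunction.coe_ofNormedAddCommGroupDiscrete, mm1Gen,
          BoundedContinuousFunction.coe_smul, smul_eq_mul, RingHom.id_apply]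
        split_ifs <;> ring }
    (2 * (lam + mu))
    fun f => (BoundedContinuousFunction.norm_le (by positivity)).2
      (abs_mm1Gen_le hlam hmu fun k => f.norm_coe_le_norm k)

/-! ### Laws on `ℕ` as functionals on the bounded functions -/

lemma abs_integral_le_norm (ν : Measure ℕ) [IsProbabilityMeasure ν]
    (f : BoundedContinuousFunction ℕ ℝ) : |∫ j, f j ∂ν| ≤ ‖f‖ := by
  simpa using f.norm_integral_le_norm ν

/-- Integration against a probability measure as a functional on the bounded functions. -/
noncomputable def lawCLM (ν : Measure ℕ) [IsProbabilityMeasure ν] :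
    BoundedContinuousFunction ℕ ℝ →L[ℝ] ℝ :=
  LinearMap.mkContinuous
    { toFun := fun f => ∫ j, f j ∂ν
      map_add' := fun f g => integral_add (f.integrable ν) (g.integrable ν)
      map_smul' := fun c f => integral_const_mul c _ }
    1 fun f => by simpa using abs_integral_le_norm ν f

@[simp] lemma lawCLM_apply (ν : Measure ℕ) [IsProbabilityMeasure ν]
    (f : BoundedContinuousFunction ℕ ℝ) : lawCLM ν f = ∫ j, f j ∂ν := rfl

lemma norm_lawCLM_le (ν : Measure ℕ) [IsProbabilityMeasure ν] : ‖lawCLM ν‖ ≤ 1 :=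
  LinearMap.mkContinuous_norm_le _ zero_le_one _

/-! ### The forward equation determines the laws -/

/-- The semigroup generated by a bounded operator. -/
noncomputable def clmSemigroup {B : Type*} [NormedAddCommGroup B] [NormedSpace ℝ B]
    (G : B →L[ℝ] B) (t : ℝ) : B →L[ℝ] B :=
  NormedSpace.exp (t • G)

lemma clmSemigroup_zero {B : Type*} [NormedAddCommGroup B] [NormedSpace ℝ B]
    (G : B →L[ℝ] B) (f : B) : clmSemigroup G 0 f = f := by
  simp [clmSemigroup]

lemma hasDerivAt_clmSemigroup {B : Type*} [NormedAddCommGroup B] [NormedSpace ℝ B]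
    [CompleteSpace B] (G : B →L[ℝ] B) (f : B) (t : ℝ) :
    HasDerivAt (fun s => clmSemigroup G s f) (G (clmSemigroup G t f)) t := by
  simpa [clmSemigroup] using (hasDerivAt_exp_smul_const' (𝕂 := ℝ) G t).clm_apply
    (hasDerivAt_const t f)

/-- A curve of functionals that solves the forward equation of a bounded operator is given by the
exponential of the operator. -/
lemma clm_eq_comp_exp_of_forward {B : Type*} [NormedAddCommGroup B] [NormedSpace ℝ B]
    [CompleteSpace B] (G : B →L[ℝ] B) (L : ℝ → B →L[ℝ] ℝ) {C : ℝ} (hC : ∀ t, ‖L t‖ ≤ C)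
    (hmeas : ∀ f, Measurable fun t => L t f)
    (hL : ∀ f t, 0 ≤ t → L t f = L 0 f + ∫ s in (0 : ℝ)..t, L s (G f)) {t : ℝ} (ht : 0 ≤ t)
    (f : B) : L t f = L 0 (clmSemigroup G t f) := by
  have hC0 : 0 ≤ C := (norm_nonneg _).trans (hC 0)
  have hint : ∀ f a b, IntervalIntegrable (fun s => L s f) volume a b := by
    intro f a b
    refine (intervalIntegrable_const (c := C * ‖f‖)).mono_fun (hmeas f).aestronglyMeasurable ?_
    refine ae_of_all _ fun s => ?_
    rw [Real.norm_of_nonneg (by positivity)]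
    exact (L s).le_of_opNorm_le (hC s) f
  -- Boundedness of `G` upgrades the equation tested on each `f` to Lipschitz continuity in operator
  -- norm, so the curve can be differentiated in the dual space.
  have hlip : LipschitzOnWith (C * ‖G‖).toNNReal L (Ici 0) := by
    refine LipschitzOnWith.of_dist_le_mul fun a ha b hb => ?_
    rw [Real.coe_toNNReal _ (by positivity), dist_eq_norm]
    refine ContinuousLinearMap.opNorm_le_bound _ (by positivity) fun f => ?_
    have : (L a - L b) f = ∫ s in b..a, L s (G f) := by
      rw [sub_apply, hL f a ha, hL f b hb,
        ← intervalIntegral.integral_interval_sub_left (hint _ 0 a) (hint _ 0 b)]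
      ring
    rw [this]
    have hb : ∀ s ∈ uIoc b a, ‖L s (G f)‖ ≤ C * (‖G‖ * ‖f‖) := fun s _ =>
      ((L s).le_of_opNorm_le (hC s) _).trans (by gcongr; exact G.le_opNorm f)
    refine (intervalIntegral.norm_integral_le_of_norm_le_const hb).trans (le_of_eq ?_)
    rw [Real.dist_eq]; ring
  set L' : ℝ → B →L[ℝ] ℝ := fun t => L (max t 0) with hL'
  have hL'c : Continuous L' :=
    hlip.continuousOn.comp_continuous (by fun_prop) fun t => le_max_right t 0
  have hcomp : Continuous fun s => (L' s).comp G := hL'c.clm_comp continuous_const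
  have heq : ∀ t, 0 ≤ t → L' t = L 0 + ∫ s in (0 : ℝ)..t, (L' s).comp G := by
    intro t ht
    ext f
    rw [add_apply,
      ContinuousLinearMap.intervalIntegral_apply (hcomp.intervalIntegrable _ _)]
    simp only [hL', max_eq_left ht]
    rw [hL f t ht]
    congr 1
    refine intervalIntegral.integral_congr fun s hs => ?_
    rw [uIcc_of_le ht] at hs
    simp [max_eq_left hs.1]
  have hder : ∀ s, 0 ≤ s → HasDerivWithinAt L' ((L' s).comp G) (Ici s) s := by
    intro s hs
    have h1 : HasDerivAt (fun t => L 0 + ∫ s in (0 : ℝ)..t, (L' s).comp G) ((L' s).comp G) s :=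
      (hcomp.integral_hasStrictDerivAt 0 s).hasDerivAt.const_add _
    exact h1.hasDerivWithinAt.congr (fun r hr => heq r (hs.trans hr)) (heq s hs)
  have hE : ∀ s : ℝ, HasDerivAt (fun r : ℝ => clmSemigroup G (t - r) f)
      (-(G (clmSemigroup G (t - s) f))) s := by
    intro s
    simpa [Function.comp_def] using (hasDerivAt_clmSemigroup G f (t - s)).scomp s
      ((hasDerivAt_id s).const_sub t)
  -- Duhamel interpolation: this curve joins the two sides of the claim, at `r = t` and `r = 0`, and
  -- the two contributions to its derivative cancel.
  have hq : ∀ s, 0 ≤ s → HasDerivWithinAt (fun r => L' r (clmSemigroup G (t - r) f)) 0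
      (Ici s) s := by
    intro s hs
    have := (hder s hs).clm_apply (hE s).hasDerivWithinAt
    simpa using this
  have hcont : ContinuousOn (fun r => L' r (clmSemigroup G (t - r) f)) (Icc 0 t) := by
    have hEc : Continuous fun r : ℝ => clmSemigroup G (t - r) f :=
      continuous_iff_continuousAt.2 fun s => (hE s).continuousAt
    exact (hL'c.clm_apply hEc).continuousOn
  have := constant_of_has_deriv_right_zero hcont (fun s hs => hq s hs.1) t ⟨ht, le_rfl⟩
  simpa [hL', max_eq_left ht, clmSemigroup_zero] using this

/-! ### Joint measurability of right-continuous processes -/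

/-- Sampling at grid times strictly to the right of `s` involves countably many times, hence is
jointly measurable; right continuity gives convergence as the mesh shrinks. -/
lemma measurable_uncurry_of_rightContinuous {Ω : Type*} [MeasurableSpace Ω] {N : ℝ≥0 → Ω → ℕ}
    (hm : ∀ t, Measurable (N t)) (hc : ∀ ω t, ContinuousWithinAt (fun s => N s ω) (Ici t) t) :
    Measurable (Function.uncurry N) := by
  let a : ℕ → ℝ≥0 → ℝ≥0 := fun n s => (⌊((n : ℝ≥0) + 1) * s⌋₊ + 1) / ((n : ℝ≥0) + 1)
  have hlow : ∀ n s, s ≤ a n s := fun n s => by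
    rw [le_div_iff₀ (by positivity), mul_comm]
    exact (Nat.lt_floor_add_one _).le
  have hup : ∀ n s, a n s ≤ s + 1 / ((n : ℝ≥0) + 1) := fun n s => by
    have h1 : (n : ℝ≥0) + 1 ≠ 0 := by positivity
    rw [div_le_iff₀ (by positivity), add_mul s, one_div_mul_cancel h1, mul_comm s]
    gcongr
    exact Nat.floor_le (by positivity)
  have hlim : ∀ s, Tendsto (fun n => a n s) atTop (𝓝[≥] s) := fun s => by
    refine tendsto_nhdsWithin_iff.2 ⟨?_, Eventually.of_forall fun n => hlow n s⟩
    refine tendsto_of_tendsto_of_tendsto_of_le_of_le tendsto_const_nhds ?_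
      (fun n => hlow n s) (fun n => hup n s)
    simpa using (tendsto_const_nhds (x := s)).add
      (tendsto_one_div_add_atTop_nhds_zero_nat (𝕜 := ℝ≥0))
  refine measurable_of_tendsto_metrizable (f := fun n (p : ℝ≥0 × Ω) => N (a n p.1) p.2) ?_ ?_
  · intro n
    have h1 : Measurable fun p : ℕ × Ω => N ((p.1 + 1) / ((n : ℝ≥0) + 1)) p.2 :=
      measurable_from_prod_countable_right fun m => hm ((m + 1) / ((n : ℝ≥0) + 1))
    have h2 : Measurable fun p : ℝ≥0 × Ω => (⌊((n : ℝ≥0) + 1) * p.1⌋₊, p.2) :=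
      (Nat.measurable_floor.comp (measurable_fst.const_mul _)).prodMk measurable_snd
    have h3 := h1.comp h2
    simp only [Function.comp_def] at h3
    exact h3
  · rw [tendsto_pi_nhds]
    rintro ⟨s, ω⟩
    exact (hc ω s).tendsto.comp (hlim s)

/-! ### Transition laws and the backward equation for bounded functions -/

section Transition

variable {Ω : Type*} [MeasurableSpace Ω] {lam mu : ℝ} {P : ℕ → Measure Ω} {N : ℝ≥0 → Ω → ℕ}

/-- The law of the customer count at time `t`, started from `k` customers. -/
noncomputable def mm1Law (P : ℕ → Measure Ω) (N : ℝ≥0 → Ω → ℕ) (k : ℕ) (t : ℝ) : Measure ℕ :=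
  (P k).map (N t.toNNReal)

/-- The mean of `g` at time `t`, started from `k` customers. -/
noncomputable def meanAt (P : ℕ → Measure Ω) (N : ℝ≥0 → Ω → ℕ) (g : ℕ → ℝ) (k : ℕ) (t : ℝ) : ℝ :=
  ∫ ω, g (N t.toNNReal ω) ∂(P k)

lemma IsMM1Family.measurable (hN : IsMM1Family lam mu P N) (t : ℝ≥0) : Measurable (N t) :=
  ((hN.isMM1Process 0).stronglyMeasurable t).measurable

lemma IsMM1Family.isProbabilityMeasure_mm1Law (hN : IsMM1Family lam mu P N) (k : ℕ) (t : ℝ) :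
    IsProbabilityMeasure (mm1Law P N k t) :=
  have := hN.isProbabilityMeasure k
  Measure.isProbabilityMeasure_map (hN.measurable _).aemeasurable

lemma IsMM1Family.integral_mm1Law (hN : IsMM1Family lam mu P N) (g : ℕ → ℝ) (k : ℕ) (t : ℝ) :
    ∫ j, g j ∂(mm1Law P N k t) = meanAt P N g k t :=
  integral_map (hN.measurable _).aemeasurable measurable_from_top.aestronglyMeasurable

lemma IsMM1Family.integrable_mm1Law_iff (hN : IsMM1Family lam mu P N) (g : ℕ → ℝ) (k : ℕ)
    (t : ℝ) :
    Integrable g (mm1Law P N k t) ↔ Integrable (fun ω => g (N t.toNNReal ω)) (P k) :=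
  integrable_map_measure measurable_from_top.aestronglyMeasurable (hN.measurable _).aemeasurable

lemma IsMM1Family.measurable_uncurry (hN : IsMM1Family lam mu P N) :
    Measurable fun p : ℝ × Ω => N p.1.toNNReal p.2 :=
  (measurable_uncurry_of_rightContinuous hN.measurable (hN.isMM1Process 0).rightContinuous).comp
    ((measurable_real_toNNReal.comp measurable_fst).prodMk measurable_snd)

lemma IsMM1Family.measurable_meanAt (hN : IsMM1Family lam mu P N) (g : ℕ → ℝ) (k : ℕ) :
    Measurable (meanAt P N g k) := by
  have := hN.isProbabilityMeasure k
  have h1 : Measurable fun p : ℝ × Ω => g (N p.1.toNNReal p.2) :=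
    measurable_from_top.comp hN.measurable_uncurry
  exact (h1.stronglyMeasurable.integral_prod_right (ν := P k)).measurable

lemma IsMM1Family.meanAt_zero (hN : IsMM1Family lam mu P N) (g : ℕ → ℝ) (k : ℕ) :
    meanAt P N g k 0 = g k := by
  have := hN.isProbabilityMeasure k
  rw [meanAt, Real.toNNReal_zero,
    integral_congr_ae (g := fun _ => g k) ((hN.start k).mono fun ω h => by simp only [h])]
  simp

lemma IsMM1Family.abs_meanAt_le (hN : IsMM1Family lam mu P N) {g : ℕ → ℝ} {C : ℝ}
    (hg : ∀ j, |g j| ≤ C) (k : ℕ) (t : ℝ) : |meanAt P N g k t| ≤ C := by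
  have := hN.isProbabilityMeasure k
  simpa [meanAt] using norm_integral_le_of_norm_le_const (μ := P k)
    (f := fun ω => g (N t.toNNReal ω)) (ae_of_all _ fun ω => hg _)

lemma IsMM1Family.integrable_of_bounded (hN : IsMM1Family lam mu P N) {g : ℕ → ℝ} {C : ℝ}
    (hg : ∀ j, |g j| ≤ C) (k : ℕ) (t : ℝ≥0) : Integrable (fun ω => g (N t ω)) (P k) := by
  have := hN.isProbabilityMeasure k
  exact Integrable.of_bound (measurable_from_top.comp (hN.measurable t)).aestronglyMeasurable C
    (ae_of_all _ fun ω => hg _)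

/-- The forward equation. -/
lemma IsMM1Family.meanAt_forward (hN : IsMM1Family lam mu P N) (hlam : 0 ≤ lam) (hmu : 0 ≤ mu)
    {g : ℕ → ℝ} {C : ℝ} (hg : ∀ j, |g j| ≤ C) (k : ℕ) {t : ℝ} (ht : 0 ≤ t) :
    meanAt P N g k t = g k + ∫ s in (0 : ℝ)..t, meanAt P N (mm1Gen lam mu g) k s := by
  have := hN.isProbabilityMeasure k
  have hG := abs_mm1Gen_le hlam hmu hg
  have hM := (hN.isMM1Process k).martingale g ⟨C, hg⟩
  have hprod : Integrable (Function.uncurry fun (s : ℝ) ω => mm1Gen lam mu g (N s.toNNReal ω))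
      ((volume.restrict (uIoc 0 t)).prod (P k)) := by
    have : IsFiniteMeasure (volume.restrict (uIoc 0 t)) :=
      ⟨by simp [uIoc]⟩
    have h1 : Measurable fun p : ℝ × Ω => mm1Gen lam mu g (N p.1.toNNReal p.2) :=
      (measurable_from_top (f := mm1Gen lam mu g)).comp hN.measurable_uncurry
    exact Integrable.of_bound h1.aestronglyMeasurable _ (ae_of_all _ fun p => hG _)
  -- The martingale has constant mean; this is read off from its conditional expectation given time
  -- `0`.
  have h0 := integral_condExp (μ := P k) (f := fun ω => g (N t.toNNReal ω) -
    ∫ s in (0 : ℝ)..t.toNNReal, mm1Gen lam mu g (N s.toNNReal ω))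
    ((Filtration.natural N (hN.isMM1Process k).stronglyMeasurable).le 0)
  rw [integral_congr_ae (hM.2 0 t.toNNReal zero_le)] at h0
  have hI : Integrable (fun ω => ∫ s in (0 : ℝ)..t, mm1Gen lam mu g (N s.toNNReal ω)) (P k) := by
    simp_rw [intervalIntegral.integral_of_le ht]
    rw [uIoc_of_le ht] at hprod
    exact hprod.integral_prod_right
  simp only [NNReal.coe_zero, intervalIntegral.integral_same, sub_zero, Real.coe_toNNReal t ht]
    at h0
  rw [integral_sub (hN.integrable_of_bounded hg k _) hI,
    ← intervalIntegral_integral_swap hprod] at h0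
  have h2 := hN.meanAt_zero g k
  simp only [meanAt, Real.toNNReal_zero] at h2 ⊢
  linarith

/-- The transition semigroup on bounded functions is generated by `mm1GenCLM`. -/
lemma IsMM1Family.meanAt_eq_clmSemigroup (hN : IsMM1Family lam mu P N) (hlam : 0 ≤ lam)
    (hmu : 0 ≤ mu)
    (f : BoundedContinuousFunction ℕ ℝ) (k : ℕ) {t : ℝ} (ht : 0 ≤ t) :
    meanAt P N f k t = clmSemigroup (mm1GenCLM lam mu hlam hmu) t f k := by
  have := hN.isProbabilityMeasure_mm1Law k
  have h := clm_eq_comp_exp_of_forward (mm1GenCLM lam mu hlam hmu)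
    (fun t => lawCLM (mm1Law P N k t)) (fun t => norm_lawCLM_le _)
    (fun f => by simpa only [lawCLM_apply, hN.integral_mm1Law] using hN.measurable_meanAt f k)
    (fun f t ht => by
      simp only [lawCLM_apply, hN.integral_mm1Law, hN.meanAt_zero]
      exact hN.meanAt_forward hlam hmu (fun j => f.norm_coe_le_norm j) k ht) ht f
  simpa only [lawCLM_apply, hN.integral_mm1Law, hN.meanAt_zero] using h

/-- The backward equation for bounded functions. -/
lemma IsMM1Family.meanAt_backward_of_bounded (hN : IsMM1Family lam mu P N) (hlam : 0 ≤ lam)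
    (hmu : 0 ≤ mu) {g : ℕ → ℝ} {C : ℝ} (hg : ∀ j, |g j| ≤ C) (k : ℕ) {t : ℝ} (ht : 0 ≤ t) :
    meanAt P N g k t =
      g k + ∫ s in (0 : ℝ)..t, mm1Gen lam mu (fun j => meanAt P N g j s) k := by
  let f := BoundedContinuousFunction.ofNormedAddCommGroupDiscrete g C hg
  have hfg : (f : ℕ → ℝ) = g := rfl
  set G := mm1GenCLM lam mu hlam hmu
  have hd : ∀ s : ℝ, HasDerivAt (fun s : ℝ => clmSemigroup G s f k)
      (mm1Gen lam mu (clmSemigroup G s f) k) s := fun s =>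
    ((BoundedContinuousFunction.evalCLM ℝ k :
      BoundedContinuousFunction ℕ ℝ →L[ℝ] ℝ).hasFDerivAt.comp_hasDerivAt s
        (hasDerivAt_clmSemigroup G f s) :)
  have hc : Continuous fun s : ℝ => mm1Gen lam mu (clmSemigroup G s f) k := by
    have h1 : Continuous fun s : ℝ => G (clmSemigroup G s f) :=
      G.continuous.comp (continuous_iff_continuousAt.2 fun s =>
        (hasDerivAt_clmSemigroup G f s).continuousAt)
    exact (BoundedContinuousFunction.evalCLM ℝ k).continuous.comp h1
  have h := intervalIntegral.integral_eq_sub_of_hasDerivAt (a := 0) (b := t)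
    (fun s _ => hd s) (hc.intervalIntegrable _ _)
  have h2 : ∫ s in (0 : ℝ)..t, mm1Gen lam mu (fun j => meanAt P N g j s) k =
      ∫ s in (0 : ℝ)..t, mm1Gen lam mu (clmSemigroup G s f) k := by
    refine intervalIntegral.integral_congr fun s hs => ?_
    rw [uIcc_of_le ht] at hs
    have : (fun j => meanAt P N g j s) = clmSemigroup G s f := by
      ext j
      rw [← hfg, hN.meanAt_eq_clmSemigroup hlam hmu f j hs.1]
    simp only [this]
  rw [h2, h, ← hfg, hN.meanAt_eq_clmSemigroup hlam hmu f k ht, clmSemigroup_zero]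
  ring

end Transition

/-! ### The stationary law -/

section Stationary

variable {Ω : Type*} [MeasurableSpace Ω] {lam mu : ℝ} {P : ℕ → Measure Ω} {N : ℝ≥0 → Ω → ℕ}
  {π : Measure ℕ}

/-- The transition laws at time `t` as a kernel. -/
noncomputable def mm1Kernel (P : ℕ → Measure Ω) (N : ℝ≥0 → Ω → ℕ) (t : ℝ) : Kernel ℕ ℕ :=
  ⟨fun k => mm1Law P N k t, measurable_from_top⟩

lemma mm1Kernel_apply (t : ℝ) (k : ℕ) : mm1Kernel P N t k = mm1Law P N k t := rfl

lemma IsStationaryLaw.bind_eq (hπ : IsStationaryLaw P N π) (hN : IsMM1Family lam mu P N) (t : ℝ) :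
    π.bind (mm1Kernel P N t) = π := by
  ext A hA
  rw [Measure.bind_apply hA (mm1Kernel P N t).aemeasurable, ← hπ.invariant t.toNNReal A]
  refine lintegral_congr fun k => ?_
  rw [mm1Kernel_apply, mm1Law, Measure.map_apply (hN.measurable _) hA]
  rfl

lemma IsStationaryLaw.integral_meanAt (hπ : IsStationaryLaw P N π) (hN : IsMM1Family lam mu P N)
    {g : ℕ → ℝ} (hg : Integrable g π) (t : ℝ) : ∫ k, meanAt P N g k t ∂π = ∫ k, g k ∂π := by
  have hg' : Integrable g (π.bind (mm1Kernel P N t)) := by rwa [hπ.bind_eq hN]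
  rw [Measure.comp_eq_comp_const_apply] at hg'
  have h := Kernel.integral_comp hg'
  rw [← Measure.comp_eq_comp_const_apply, Kernel.const_apply] at h
  rw [hπ.bind_eq hN] at h
  simp only [mm1Kernel_apply, hN.integral_mm1Law] at h
  exact h.symm

/-- The global balance equations hold for every bounded test function. -/
lemma IsStationaryLaw.integral_mm1Gen (hπ : IsStationaryLaw P N π) (hN : IsMM1Family lam mu P N)
    (hlam : 0 ≤ lam) (hmu : 0 ≤ mu) {g : ℕ → ℝ} {C : ℝ} (hg : ∀ j, |g j| ≤ C) :
    ∫ k, mm1Gen lam mu g k ∂π = 0 := by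
  have := hπ.isProbabilityMeasure
  let f := BoundedContinuousFunction.ofNormedAddCommGroupDiscrete g C hg
  set G := mm1GenCLM lam mu hlam hmu
  have h1 : HasDerivAt (fun t : ℝ => lawCLM π (clmSemigroup G t f)) (lawCLM π (G f)) 0 := by
    have h := (lawCLM π).hasFDerivAt.comp_hasDerivAt 0 (hasDerivAt_clmSemigroup G f 0)
    rw [clmSemigroup_zero] at h
    exact h
  have h2 : ∀ t ∈ Ici (0 : ℝ), lawCLM π (clmSemigroup G t f) = lawCLM π f := by
    intro t ht
    rw [lawCLM_apply, lawCLM_apply, ← hπ.integral_meanAt hN (f.integrable π) t]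
    exact integral_congr_ae (ae_of_all _ fun k => (hN.meanAt_eq_clmSemigroup hlam hmu f k ht).symm)
  -- Stationarity gives constancy only for nonnegative times, so the one-sided derivative is used.
  have h3 : HasDerivWithinAt (fun t : ℝ => lawCLM π (clmSemigroup G t f)) 0 (Ici 0) 0 :=
    (hasDerivWithinAt_const (0 : ℝ) (Ici 0) (lawCLM π f)).congr h2 (h2 0 self_mem_Ici)
  exact (uniqueDiffOn_Ici (0 : ℝ) 0 self_mem_Ici).eq_deriv _ h1.hasDerivWithinAt h3

/-- Testing the balance equation with the indicator of `{0, …, k}` isolates the flow between `k` and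
`k + 1`. -/
lemma IsStationaryLaw.measureReal_singleton_succ (hπ : IsStationaryLaw P N π)
    (hN : IsMM1Family lam mu P N) (hlam : 0 ≤ lam) (hmu : 0 ≤ mu) (k : ℕ) :
    mu * π.real {k + 1} = lam * π.real {k} := by
  have := hπ.isProbabilityMeasure
  have h := hπ.integral_mm1Gen hN hlam hmu (g := fun j => if j ≤ k then 1 else 0) (C := 1)
    (fun j => by split_ifs <;> simp)
  have h2 : mm1Gen lam mu (fun j => if j ≤ k then 1 else 0) = fun j =>
      mu * ({k + 1} : Set ℕ).indicator 1 j - lam * ({k} : Set ℕ).indicator 1 j := by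
    ext j
    simp only [mm1Gen, Set.indicator, Set.mem_singleton_iff, Pi.one_apply]
    split_ifs <;> first | (exfalso; omega) | simp
  have hi : ∀ i : ℕ, Integrable (({i} : Set ℕ).indicator (1 : ℕ → ℝ)) π := fun i =>
    (integrable_const (1 : ℝ)).indicator (measurableSet_singleton i)
  rw [h2, integral_sub ((hi _).const_mul _) ((hi _).const_mul _), integral_const_mul,
    integral_const_mul, integral_indicator_one (measurableSet_singleton _),
    integral_indicator_one (measurableSet_singleton _)] at h
  linarith

lemma IsStationaryLaw.measureReal_singleton (hπ : IsStationaryLaw P N π)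
    (hN : IsMM1Family lam mu P N) (hlam : 0 ≤ lam) (hmu : 0 < mu) (k : ℕ) :
    π.real {k} = π.real {0} * (lam / mu) ^ k := by
  induction k with
  | zero => simp
  | succ k ih =>
    have := hπ.measureReal_singleton_succ hN hlam hmu.le k
    rw [pow_succ, ← mul_assoc, ← ih]
    field_simp
    linarith

lemma IsStationaryLaw.measureReal_singleton_pos (hπ : IsStationaryLaw P N π)
    (hN : IsMM1Family lam mu P N) (hlam : 0 < lam) (hmu : 0 < mu) (k : ℕ) : 0 < π.real {k} := by
  have := hπ.isProbabilityMeasure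
  rw [hπ.measureReal_singleton hN hlam.le hmu]
  have h0 : 0 < π.real {0} := by
    refine measureReal_nonneg.lt_of_ne fun h => ?_
    have h1 : ∀ k : ℕ, π {k} = 0 := fun k => by
      rw [← measureReal_eq_zero_iff, hπ.measureReal_singleton hN hlam.le hmu, ← h, zero_mul]
    have h2 : π univ = 0 := by
      rw [← Set.iUnion_of_singleton ℕ]
      exact measure_iUnion_null h1
    simp at h2
  positivity

/-- Every state is an atom of positive mass, so almost sure statements hold for every starting
state. -/
lemma IsStationaryLaw.ae_iff (hπ : IsStationaryLaw P N π)
    (hN : IsMM1Family lam mu P N) (hlam : 0 < lam) (hmu : 0 < mu) {p : ℕ → Prop} :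
    (∀ᵐ k ∂π, p k) ↔ ∀ k, p k := by
  have := hπ.isProbabilityMeasure
  rw [ae_iff_of_countable]
  refine forall_congr' fun k => ⟨fun h => h fun h0 => ?_, fun h _ => h⟩
  exact (hπ.measureReal_singleton_pos hN hlam hmu k).ne' (by simp [Measure.real, h0])

/-- Functions with a finite stationary mean have finite means at all times. -/
lemma IsStationaryLaw.integrable (hπ : IsStationaryLaw P N π)
    (hN : IsMM1Family lam mu P N) (hlam : 0 < lam) (hmu : 0 < mu) {g : ℕ → ℝ}
    (hg : Integrable g π) (k : ℕ) (t : ℝ≥0) : Integrable (fun ω => g (N t ω)) (P k) := by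
  have hg' : Integrable g (π.bind (mm1Kernel P N t)) := by rwa [hπ.bind_eq hN]
  have h := (hπ.ae_iff hN hlam hmu).1
    ((Measure.integrable_comp_iff measurable_from_top.aestronglyMeasurable).1 hg').1 k
  rw [mm1Kernel_apply, hN.integrable_mm1Law_iff] at h
  simpa using h

/-- Means at time `t` are controlled by the stationary mean. -/
lemma IsStationaryLaw.meanAt_abs_le (hπ : IsStationaryLaw P N π)
    (hN : IsMM1Family lam mu P N) (hlam : 0 < lam) (hmu : 0 < mu) {g : ℕ → ℝ}
    (hg : Integrable g π) (k : ℕ) (t : ℝ) :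
    meanAt P N (fun j => |g j|) k t ≤ (∫ j, |g j| ∂π) / π.real {k} := by
  have := hπ.isProbabilityMeasure
  rw [le_div_iff₀ (hπ.measureReal_singleton_pos hN hlam hmu k),
    ← hπ.integral_meanAt hN hg.abs t]
  have hg' : Integrable g (π.bind (mm1Kernel P N t)) := by rwa [hπ.bind_eq hN]
  have h := ((Measure.integrable_comp_iff measurable_from_top.aestronglyMeasurable).1 hg').2
  simp only [mm1Kernel_apply, Real.norm_eq_abs, hN.integral_mm1Law] at h
  have hnn : ∀ j, 0 ≤ meanAt P N (fun j => |g j|) j t := fun j =>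
    integral_nonneg fun ω => abs_nonneg _
  have h1 := setIntegral_le_integral h (ae_of_all _ hnn) (s := {k})
  rw [integral_singleton, smul_eq_mul] at h1
  linarith

end Stationary

/-! ### The backward equation for functions with a finite stationary mean -/

lemma abs_mm1Gen_le_of_abs_le {lam mu : ℝ} (hlam : 0 ≤ lam) (hmu : 0 ≤ mu) {f b : ℕ → ℝ}
    (hf : ∀ k, |f k| ≤ b k) (k : ℕ) :
    |mm1Gen lam mu f k| ≤ lam * (b (k + 1) + b k) + mu * (b k + b (k - 1)) := by
  have hb : ∀ k, 0 ≤ b k := fun k => (abs_nonneg _).trans (hf k)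
  have h1 : |lam * (f (k + 1) - f k)| ≤ lam * (b (k + 1) + b k) := by
    rw [abs_mul, abs_of_nonneg hlam]
    gcongr
    exact (abs_sub _ _).trans (add_le_add (hf _) (hf _))
  have h2 : |if 0 < k then mu * (f k - f (k - 1)) else 0| ≤ mu * (b k + b (k - 1)) := by
    split_ifs
    · rw [abs_mul, abs_of_nonneg hmu]
      gcongr
      exact (abs_sub _ _).trans (add_le_add (hf _) (hf _))
    · rw [abs_zero]
      exact mul_nonneg hmu (add_nonneg (hb _) (hb _))
  rw [mm1Gen]
  exact (abs_sub _ _).trans (add_le_add h1 h2)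

lemma tendsto_mm1Gen {ι : Type*} {l : Filter ι} {lam mu : ℝ} {F : ι → ℕ → ℝ} {f : ℕ → ℝ}
    (h : ∀ k, Tendsto (fun i => F i k) l (𝓝 (f k))) (k : ℕ) :
    Tendsto (fun i => mm1Gen lam mu (F i) k) l (𝓝 (mm1Gen lam mu f k)) := by
  unfold mm1Gen
  refine (((h _).sub (h _)).const_mul _).sub ?_
  split_ifs
  · exact ((h _).sub (h _)).const_mul _
  · exact tendsto_const_nhds

section Backward

variable {Ω : Type*} [MeasurableSpace Ω] {lam mu : ℝ} {P : ℕ → Measure Ω} {N : ℝ≥0 → Ω → ℕ}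
  {π : Measure ℕ}

lemma IsMM1Family.measurable_mm1Gen_meanAt (hN : IsMM1Family lam mu P N) (g : ℕ → ℝ) (k : ℕ) :
    Measurable fun s => mm1Gen lam mu (fun j => meanAt P N g j s) k := by
  have h := hN.measurable_meanAt g
  unfold mm1Gen
  refine (((h _).sub (h _)).const_mul _).sub ?_
  split_ifs
  · exact ((h _).sub (h _)).const_mul _
  · exact measurable_const

/-- A bound for the means of `g` that is uniform in time. -/
noncomputable def meanBound (π : Measure ℕ) (g : ℕ → ℝ) (k : ℕ) : ℝ :=
  (∫ j, |g j| ∂π) / π.real {k}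

lemma IsStationaryLaw.abs_meanAt_le_of_abs_le (hπ : IsStationaryLaw P N π)
    (hN : IsMM1Family lam mu P N) (hlam : 0 < lam) (hmu : 0 < mu) {f g : ℕ → ℝ}
    (hg : Integrable g π) (hfg : ∀ j, |f j| ≤ |g j|) (k : ℕ) (t : ℝ) :
    |meanAt P N f k t| ≤ meanBound π g k :=
  (norm_integral_le_of_norm_le (f := fun ω => f (N t.toNNReal ω))
    (hπ.integrable hN hlam hmu hg k t.toNNReal).abs (ae_of_all _ fun _ => hfg _)).trans
      (hπ.meanAt_abs_le hN hlam hmu hg k t)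

lemma IsStationaryLaw.intervalIntegrable_mm1Gen_meanAt (hπ : IsStationaryLaw P N π)
    (hN : IsMM1Family lam mu P N) (hlam : 0 < lam) (hmu : 0 < mu) {g : ℕ → ℝ}
    (hg : Integrable g π) (k : ℕ) (a b : ℝ) :
    IntervalIntegrable (fun s => mm1Gen lam mu (fun j => meanAt P N g j s) k) volume a b := by
  refine (intervalIntegrable_const (c := lam * (meanBound π g (k + 1) + meanBound π g k) +
      mu * (meanBound π g k + meanBound π g (k - 1)))).mono_fun
    (hN.measurable_mm1Gen_meanAt g k).aestronglyMeasurable (ae_of_all _ fun s => ?_)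
  exact (abs_mm1Gen_le_of_abs_le hlam.le hmu.le (fun j =>
    hπ.abs_meanAt_le_of_abs_le hN hlam hmu hg (fun _ => le_rfl) j s) k).trans (le_abs_self _)

/-- The backward equation. -/
lemma IsStationaryLaw.meanAt_backward (hπ : IsStationaryLaw P N π)
    (hN : IsMM1Family lam mu P N) (hlam : 0 < lam) (hmu : 0 < mu) {g : ℕ → ℝ}
    (hg : Integrable g π) (k : ℕ) {t : ℝ} (ht : 0 ≤ t) :
    meanAt P N g k t =
      g k + ∫ s in (0 : ℝ)..t, mm1Gen lam mu (fun j => meanAt P N g j s) k := by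
  -- Finitely supported truncations are bounded and dominated by `|g|`; `meanBound` then dominates
  -- uniformly in `n` and in time.
  let f : ℕ → ℕ → ℝ := fun n j => if j < n then g j else 0
  have hfg : ∀ n j, |f n j| ≤ |g j| := fun n j => by
    simp only [f]; split_ifs <;> simp
  have hfb : ∀ n j, |f n j| ≤ ∑ i ∈ Finset.range n, |g i| := fun n j => by
    simp only [f]
    split_ifs with hj
    · exact Finset.single_le_sum (f := fun i => |g i|) (fun i _ => abs_nonneg _)
        (Finset.mem_range.2 hj)
    · rw [abs_zero]; positivity
  have hflim : ∀ j, Tendsto (fun n => f n j) atTop (𝓝 (g j)) := fun j =>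
    tendsto_const_nhds.congr' <| (eventually_gt_atTop j).mono fun n hn => by simp [f, hn]
  have hlim : ∀ k t, Tendsto (fun n => meanAt P N (f n) k t) atTop (𝓝 (meanAt P N g k t)) :=
    fun k t => tendsto_integral_of_dominated_convergence _
      (fun n => ((measurable_from_top (f := f n)).comp (hN.measurable _)).aestronglyMeasurable)
      (hπ.integrable hN hlam hmu hg k t.toNNReal).abs (fun n => ae_of_all _ fun _ => hfg n _)
      (ae_of_all _ fun _ => hflim _)
  have hint : Tendsto (fun n => ∫ s in (0 : ℝ)..t, mm1Gen lam mu (fun j => meanAt P N (f n) j s) k)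
      atTop (𝓝 (∫ s in (0 : ℝ)..t, mm1Gen lam mu (fun j => meanAt P N g j s) k)) :=
    intervalIntegral.tendsto_integral_filter_of_dominated_convergence
      (fun _ => lam * (meanBound π g (k + 1) + meanBound π g k) +
        mu * (meanBound π g k + meanBound π g (k - 1)))
      (Eventually.of_forall fun n => (hN.measurable_mm1Gen_meanAt _ k).aestronglyMeasurable)
      (Eventually.of_forall fun n => ae_of_all _ fun s _ =>
        abs_mm1Gen_le_of_abs_le hlam.le hmu.le (fun j =>
          hπ.abs_meanAt_le_of_abs_le hN hlam hmu hg (hfg n) j s) k)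
      intervalIntegrable_const
      (ae_of_all _ fun s _ => tendsto_mm1Gen (fun j => hlim j s) k)
  refine tendsto_nhds_unique (hlim k t) (((hflim k).add hint).congr fun n => ?_)
  exact (hN.meanAt_backward_of_bounded hlam.le hmu.le (hfb n) k ht).symm

lemma IsStationaryLaw.continuous_meanAt (hπ : IsStationaryLaw P N π)
    (hN : IsMM1Family lam mu P N) (hlam : 0 < lam) (hmu : 0 < mu) {g : ℕ → ℝ}
    (hg : Integrable g π) (k : ℕ) : Continuous (meanAt P N g k) := by
  -- At negative times `meanAt` keeps its value at `0`, so the primitive evaluated at `max t 0`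
  -- represents it on the whole line.
  have h := (intervalIntegral.continuous_primitive
    (hπ.intervalIntegrable_mm1Gen_meanAt hN hlam hmu hg k) 0).comp
      (continuous_id.max (continuous_const (y := (0 : ℝ))))
  refine (h.const_add (g k)).congr fun t => ?_
  simp only [Function.comp_apply, id]
  rw [← hπ.meanAt_backward hN hlam hmu hg k (le_max_right t 0)]
  simp only [meanAt]
  congr 3 with ω
  rcases le_total t 0 with ht | ht <;> simp [ht, Real.toNNReal_of_nonpos]

lemma IsStationaryLaw.hasDerivAt_meanAt (hπ : IsStationaryLaw P N π)
    (hN : IsMM1Family lam mu P N) (hlam : 0 < lam) (hmu : 0 < mu) {g : ℕ → ℝ}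
    (hg : Integrable g π) (k : ℕ) {t : ℝ} (ht : 0 < t) :
    HasDerivAt (meanAt P N g k) (mm1Gen lam mu (fun j => meanAt P N g j t) k) t := by
  have hc : Continuous fun s => mm1Gen lam mu (fun j => meanAt P N g j s) k :=
    continuous_iff_continuousAt.2 fun s =>
      tendsto_mm1Gen (fun j => (hπ.continuous_meanAt hN hlam hmu hg j).continuousAt) k
  refine ((hc.integral_hasStrictDerivAt 0 t).hasDerivAt.const_add (g k)).congr_of_eventuallyEq ?_
  filter_upwards [eventually_ge_nhds ht] with s hs
  exact hπ.meanAt_backward hN hlam hmu hg k hs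

/-! ### Moments -/

lemma IsStationaryLaw.integrable_pow (hπ : IsStationaryLaw P N π)
    (hN : IsMM1Family lam mu P N) (hlam : 0 < lam) (hlm : lam < mu) (m : ℕ) :
    Integrable (fun j : ℕ => (j : ℝ) ^ m) π := by
  have := hπ.isProbabilityMeasure
  have hmu := hlam.trans hlm
  refine ⟨measurable_from_top.aestronglyMeasurable, ?_⟩
  have hs : Summable fun j : ℕ => π.real {0} * ((j : ℝ) ^ m * (lam / mu) ^ j) := by
    have hr : ‖lam / mu‖ < 1 := by
      rw [Real.norm_of_nonneg (by positivity), div_lt_one hmu]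
      exact hlm
    exact (summable_pow_mul_geometric_of_norm_lt_one m hr).mul_left _
  rw [HasFiniteIntegral, lintegral_countable']
  refine lt_of_le_of_lt (le_of_eq (tsum_congr fun j => ?_)) hs.tsum_ofReal_lt_top
  rw [Real.enorm_of_nonneg (by positivity), ← ofReal_measureReal,
    hπ.measureReal_singleton hN hlam.le hmu, ← ENNReal.ofReal_mul (by positivity)]
  congr 1
  ring

lemma IsStationaryLaw.integrable_natCast (hπ : IsStationaryLaw P N π)
    (hN : IsMM1Family lam mu P N) (hlam : 0 < lam) (hlm : lam < mu) :
    Integrable (fun j : ℕ => (j : ℝ)) π := by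
  simpa using hπ.integrable_pow hN hlam hlm 1

/-- Departures only lower the truncated count, so the generator maps it to at most `lam`. The bound
does not involve `n`, so the truncation can be removed. -/
lemma IsMM1Family.meanAt_min_le (hN : IsMM1Family lam mu P N) (hlam : 0 ≤ lam) (hmu : 0 ≤ mu)
    (n k : ℕ) {t : ℝ} (ht : 0 ≤ t) :
    meanAt P N (fun j => ((min j n : ℕ) : ℝ)) k t ≤ k + lam * t := by
  have hb : ∀ j, |((min j n : ℕ) : ℝ)| ≤ n := fun j => by
    rw [Nat.abs_cast]; exact_mod_cast min_le_right j n
  have hG : ∀ j, mm1Gen lam mu (fun j => ((min j n : ℕ) : ℝ)) j ≤ lam := by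
    intro j
    have h1 : ((min (j + 1) n : ℕ) : ℝ) - (min j n : ℕ) ≤ 1 := by
      rw [sub_le_iff_le_add]; norm_cast; omega
    have h2 : 0 ≤ ((min j n : ℕ) : ℝ) - (min (j - 1) n : ℕ) := by
      rw [sub_nonneg]; norm_cast; omega
    have h3 : 0 ≤ if 0 < j then mu * (((min j n : ℕ) : ℝ) - (min (j - 1) n : ℕ)) else 0 := by
      split_ifs
      · exact mul_nonneg hmu h2
      · exact le_rfl
    have := mul_le_mul_of_nonneg_left h1 hlam
    simp only [mm1Gen]
    linarith
  have hm : ∀ s, meanAt P N (mm1Gen lam mu fun j => ((min j n : ℕ) : ℝ)) k s ≤ lam := by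
    intro s
    have := hN.isProbabilityMeasure k
    have h := integral_mono (μ := P k)
      (hN.integrable_of_bounded (abs_mm1Gen_le hlam hmu hb) k s.toNNReal)
      (integrable_const lam) fun ω => hG (N s.toNNReal ω)
    simpa [meanAt] using h
  rw [hN.meanAt_forward hlam hmu hb k ht]
  refine add_le_add (by exact_mod_cast min_le_left k n) ?_
  have hi : IntervalIntegrable
      (meanAt P N (mm1Gen lam mu fun j => ((min j n : ℕ) : ℝ)) k) volume 0 t :=
    (intervalIntegrable_const (c := 2 * (lam + mu) * n)).mono_fun
      (hN.measurable_meanAt _ k).aestronglyMeasurable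
      (ae_of_all _ fun s => (hN.abs_meanAt_le (abs_mm1Gen_le hlam hmu hb) k s).trans
        (le_abs_self _))
  have h := intervalIntegral.integral_mono_on ht hi
    (intervalIntegrable_const (c := lam)) fun s _ => hm s
  simpa [mul_comm] using h

lemma IsStationaryLaw.meanAt_natCast_le (hπ : IsStationaryLaw P N π)
    (hN : IsMM1Family lam mu P N) (hlam : 0 < lam) (hlm : lam < mu) (k : ℕ) {t : ℝ}
    (ht : 0 ≤ t) : meanAt P N (fun j => (j : ℝ)) k t ≤ k + lam * t := by
  have hmu := hlam.trans hlm
  have hlim : Tendsto (fun n => meanAt P N (fun j => ((min j n : ℕ) : ℝ)) k t) atTop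
      (𝓝 (meanAt P N (fun j => (j : ℝ)) k t)) := by
    refine tendsto_integral_of_dominated_convergence _
      (fun n => ((measurable_from_top (f := fun j => ((min j n : ℕ) : ℝ))).comp
        (hN.measurable _)).aestronglyMeasurable)
      (hπ.integrable hN hlam hmu (hπ.integrable_natCast hN hlam hlm) k t.toNNReal)
      (fun n => ae_of_all _ fun ω => ?_) (ae_of_all _ fun ω => ?_)
    · simp only
      rw [Real.norm_of_nonneg (by positivity)]
      exact_mod_cast min_le_left _ _
    · exact tendsto_const_nhds.congr' <| (eventually_ge_atTop (N t.toNNReal ω)).mono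
        fun n hn => by simp only [min_eq_left hn]
  exact le_of_tendsto' hlim fun n => hN.meanAt_min_le hlam.le hmu.le n k ht

/-- `meanBound` grows like `(mu / lam) ^ k`, too fast for the comparison principles; this bound is
linear in `k` at fixed time. -/
lemma IsStationaryLaw.abs_meanAt_le_of_linear_growth (hπ : IsStationaryLaw P N π)
    (hN : IsMM1Family lam mu P N) (hlam : 0 < lam) (hlm : lam < mu) {g : ℕ → ℝ} {a b : ℝ}
    (hb : 0 ≤ b) (hg : ∀ j : ℕ, |g j| ≤ a + b * j) (k : ℕ) {t : ℝ} (ht : 0 ≤ t) :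
    |meanAt P N g k t| ≤ a + b * (k + lam * t) := by
  have := hN.isProbabilityMeasure k
  have hi := hπ.integrable hN hlam (hlam.trans hlm) (hπ.integrable_natCast hN hlam hlm) k
    t.toNNReal
  have h := norm_integral_le_of_norm_le (μ := P k) (f := fun ω => g (N t.toNNReal ω))
    ((integrable_const a).add (hi.const_mul b)) (ae_of_all _ fun ω => hg _)
  simp only [Pi.add_apply] at h
  rw [integral_add (integrable_const a) (hi.const_mul b), integral_const_mul] at h
  refine h.trans ?_
  have := mul_le_mul_of_nonneg_left (hπ.meanAt_natCast_le hN hlam hlm k ht) hb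
  simpa [meanAt] using this

end Backward

/-! ### Comparison principles -/

/-- A sequence that grows at most linearly but satisfies `mu * e k ≤ lam * e (k + 1)` with
`lam < mu` is nonpositive. -/
lemma nonpos_of_linear_growth {lam mu C : ℝ} (hlam : 0 < lam) (hlm : lam < mu) {e : ℕ → ℝ}
    (he : ∀ k, mu * e k ≤ lam * e (k + 1)) (hC : ∀ k : ℕ, e k ≤ C * (k + 1)) (k : ℕ) :
    e k ≤ 0 := by
  have hmu := hlam.trans hlm
  set r := lam / mu
  have hr0 : 0 < r := div_pos hlam hmu
  have hr1 : r < 1 := (div_lt_one hmu).2 hlm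
  have hstep : ∀ k, e k ≤ r * e (k + 1) := fun k => by
    rw [div_mul_eq_mul_div, le_div_iff₀ hmu, mul_comm]
    exact he k
  -- The factor `r ^ n` beats the linear growth of `e (k + n)`.
  have hiter : ∀ n, e k ≤ r ^ n * e (k + n) := by
    intro n
    induction n with
    | zero => simp
    | succ n ih =>
      refine ih.trans ?_
      rw [pow_succ, mul_assoc]
      exact mul_le_mul_of_nonneg_left (hstep _) (by positivity)
  have hb : ∀ n : ℕ, e k ≤ C * (n * r ^ n) + C * (k + 1) * r ^ n := fun n => by
    refine (hiter n).trans ((mul_le_mul_of_nonneg_left (hC _) (by positivity)).trans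
      (le_of_eq ?_))
    push_cast
    ring
  have hlim : Tendsto (fun n : ℕ => C * (n * r ^ n) + C * (k + 1) * r ^ n) atTop (𝓝 0) := by
    simpa using ((tendsto_self_mul_const_pow_of_lt_one hr0.le hr1).const_mul C).add
      ((tendsto_pow_atTop_nhds_zero_of_lt_one hr0.le hr1).const_mul (C * (k + 1)))
  exact ge_of_tendsto' hlim hb

/-- The maximum principle for the generator killed at the origin. -/
lemma le_of_subsolution {lam mu C d : ℝ} (hlam : 0 < lam) (hlm : lam < mu) (hd : 0 ≤ d)
    {w : ℕ → ℝ} (h0 : w 0 = 0) (hw : ∀ k, 0 ≤ w k) (hC : ∀ k : ℕ, w k ≤ C * (k + 1))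
    (hsub : ∀ k, (lam + mu) * w (k + 1) ≤ d + lam * w (k + 2) + mu * w k) (k : ℕ) :
    w k ≤ d * k / (mu - lam) := by
  have hml : 0 < mu - lam := sub_pos.2 hlm
  -- The function `c * k` satisfies the inequality `hsub` with equality; the excess of the
  -- increments of `w` over `c` is then shown nonpositive.
  set c := d / (mu - lam)
  have hc0 : 0 ≤ c := by positivity
  have hc : (mu - lam) * c = d := by simp only [c]; field_simp
  have hinc : ∀ k, w (k + 1) - w k - c ≤ 0 := by
    refine nonpos_of_linear_growth (C := 2 * |C|) hlam hlm (fun k => ?_) (fun k => ?_)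
    · have := hsub k
      linarith
    · have h1 := hC (k + 1)
      have h2 := hw k
      have h3 : C * ((k + 1 : ℕ) + 1) ≤ |C| * ((k + 1 : ℕ) + 1) := by
        gcongr; exact le_abs_self C
      have h4 : 0 ≤ |C| * k := by positivity
      push_cast at h1 h3
      linarith
  have hk : w k ≤ c * k := by
    induction k with
    | zero => simp [h0]
    | succ k ih =>
      have := hinc k
      push_cast
      linarith
  exact hk.trans (le_of_eq (by simp only [c]; ring))

/-- The integral of the absolute value of a solution of a damped linear equation. -/
lemma mul_integral_abs_le {c : ℝ} {v r q : ℝ → ℝ} (hv : Continuous v)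
    (hr : Continuous r) (hq : Continuous q) (hrq : ∀ t, |r t| ≤ q t)
    (hd : ∀ t, 0 < t → HasDerivAt v (r t - c * v t) t) (hc : 0 ≤ c) {T : ℝ} (hT : 0 ≤ T) :
    c * ∫ t in (0 : ℝ)..T, |v t| ≤ |v 0| + ∫ t in (0 : ℝ)..T, q t := by
  set I : ℝ → ℝ := fun t => ∫ s in (0 : ℝ)..t, Real.exp (c * s) * q s
  have hqe : Continuous fun s => Real.exp (c * s) * q s := by fun_prop
  have hre : Continuous fun s => Real.exp (c * s) * r s := by fun_prop
  have hexp : ∀ t, HasDerivAt (fun s => Real.exp (c * s)) (c * Real.exp (c * t)) t := fun t => by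
    simpa [mul_comm] using ((hasDerivAt_id t).const_mul c).exp
  have hI : ∀ t, HasDerivAt I (Real.exp (c * t) * q t) t := fun t =>
    (hqe.integral_hasStrictDerivAt 0 t).hasDerivAt
  -- `A` solves `A' = q - c * A` with `A 0 = |v 0|` and dominates `|v|` by variation of constants,
  -- so `|v|` need not be differentiated. Integrating this equation and dropping `A T ≥ 0` gives the
  -- claim.
  set A : ℝ → ℝ := fun t => Real.exp (-c * t) * (|v 0| + I t) with hA
  have hAd : ∀ t, HasDerivAt A (q t - c * A t) t := by
    intro t
    have h1 : HasDerivAt (fun s => Real.exp (-c * s)) (-c * Real.exp (-c * t)) t := by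
      simpa [mul_comm] using ((hasDerivAt_id t).const_mul (-c)).exp
    refine (h1.mul ((hI t).const_add |v 0|)).congr_deriv ?_
    have h2 : Real.exp (-c * t) * Real.exp (c * t) = 1 := by
      rw [← Real.exp_add]; simp
    simp only [hA]
    linear_combination q t * h2
  have hAc : Continuous A := continuous_iff_continuousAt.2 fun t => (hAd t).continuousAt
  have hvA : ∀ t, 0 ≤ t → |v t| ≤ A t := by
    intro t ht
    have h1 := intervalIntegral.integral_eq_sub_of_hasDerivAt_of_le ht
      (f := fun s => Real.exp (c * s) * v s) (f' := fun s => Real.exp (c * s) * r s)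
      (by fun_prop)
      (fun s hs => ((hexp s).mul (hd s hs.1)).congr_deriv (by ring))
      (hre.intervalIntegrable _ _)
    have h2 : |∫ s in (0 : ℝ)..t, Real.exp (c * s) * r s| ≤ I t := by
      refine (intervalIntegral.abs_integral_le_integral_abs ht).trans ?_
      refine intervalIntegral.integral_mono_on ht (hre.abs.intervalIntegrable _ _)
        (hqe.intervalIntegrable _ _) fun s _ => ?_
      rw [abs_mul, abs_of_pos (Real.exp_pos _)]
      gcongr
      exact hrq s
    simp only [mul_zero, Real.exp_zero, one_mul] at h1
    have h3 : Real.exp (c * t) * |v t| ≤ |v 0| + I t := by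
      rw [← abs_of_pos (Real.exp_pos (c * t)), ← abs_mul]
      calc _ = |v 0 + ∫ s in (0 : ℝ)..t, Real.exp (c * s) * r s| := by
            rw [h1]; congr 1; ring
        _ ≤ _ := (abs_add_le _ _).trans (by gcongr)
    calc |v t| = Real.exp (-c * t) * (Real.exp (c * t) * |v t|) := by
          rw [← mul_assoc, ← Real.exp_add]; simp
      _ ≤ A t := by simp only [hA]; gcongr
  have hint : ∫ t in (0 : ℝ)..T, (q t - c * A t) = A T - A 0 :=
    intervalIntegral.integral_eq_sub_of_hasDerivAt (fun t _ => hAd t)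
      ((hq.sub (hAc.const_mul c)).intervalIntegrable _ _)
  rw [intervalIntegral.integral_sub (hq.intervalIntegrable _ _)
    ((hAc.const_mul c).intervalIntegrable _ _), intervalIntegral.integral_const_mul] at hint
  have h0 : A 0 = |v 0| := by simp [hA, I]
  have hAT : 0 ≤ A T := (abs_nonneg _).trans (hvA T hT)
  have hmono : ∫ t in (0 : ℝ)..T, |v t| ≤ ∫ t in (0 : ℝ)..T, A t :=
    intervalIntegral.integral_mono_on hT (hv.abs.intervalIntegrable _ _)
      (hAc.intervalIntegrable _ _) fun t ht => hvA t ht.1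
  have := mul_le_mul_of_nonneg_left hmono hc
  linarith

lemma integrableOn_Ioi_of_integral_abs_le {f : ℝ → ℝ} (hf : Continuous f) {B : ℝ}
    (h : ∀ T, 0 ≤ T → ∫ t in (0 : ℝ)..T, |f t| ≤ B) :
    IntegrableOn f (Ioi 0) ∧ ∫ t in Ioi (0 : ℝ), |f t| ≤ B := by
  have h1 : IntegrableOn f (Ioi 0) :=
    integrableOn_Ioi_of_intervalIntegral_norm_bounded B 0 (b := id) (l := atTop)
      (fun i => (hf.integrableOn_Icc).mono_set Ioc_subset_Icc_self) tendsto_id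
      ((eventually_ge_atTop 0).mono fun T hT => h T hT)
  refine ⟨h1, ?_⟩
  exact le_of_tendsto (intervalIntegral_tendsto_integral_Ioi 0 h1.abs tendsto_id)
    ((eventually_ge_atTop 0).mono fun T hT => h T hT)

/-! ### Integrability in time for Lipschitz functions -/

section Lipschitz

variable {Ω : Type*} [MeasurableSpace Ω] {lam mu : ℝ} {P : ℕ → Measure Ω} {N : ℝ≥0 → Ω → ℕ}
  {π : Measure ℕ} {g : ℕ → ℝ} {d : ℝ}

lemma abs_le_of_lipschitz (hg : ∀ k, |g (k + 1) - g k| ≤ d) (k : ℕ) :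
    |g k| ≤ |g 0| + d * k := by
  induction k with
  | zero => simp
  | succ k ih =>
    have h1 := abs_add_le (g (k + 1) - g k) (g k)
    rw [sub_add_cancel] at h1
    have := hg k
    push_cast
    linarith

lemma IsStationaryLaw.integrable_of_lipschitz (hπ : IsStationaryLaw P N π)
    (hN : IsMM1Family lam mu P N) (hlam : 0 < lam) (hlm : lam < mu)
    (hg : ∀ k, |g (k + 1) - g k| ≤ d) : Integrable g π := by
  have := hπ.isProbabilityMeasure
  exact ((integrable_const |g 0|).add ((hπ.integrable_natCast hN hlam hlm).const_mul d)).mono'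
    measurable_from_top.aestronglyMeasurable (ae_of_all _ fun k => abs_le_of_lipschitz hg k)

lemma IsStationaryLaw.integral_abs_meanAt_succ_sub_le (hπ : IsStationaryLaw P N π)
    (hN : IsMM1Family lam mu P N) (hlam : 0 < lam) (hlm : lam < mu)
    (hg : ∀ k, |g (k + 1) - g k| ≤ d) (k : ℕ) {T : ℝ} (hT : 0 ≤ T) :
    ∫ t in (0 : ℝ)..T, |meanAt P N g (k + 1) t - meanAt P N g k t| ≤
      d * (k + 1) / (mu - lam) := by
  have hmu := hlam.trans hlm
  have hd : 0 ≤ d := (abs_nonneg _).trans (hg 0)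
  have hgi := hπ.integrable_of_lipschitz hN hlam hlm hg
  set u := meanAt P N g with hu
  have huc : ∀ k, Continuous (u k) := hπ.continuous_meanAt hN hlam hmu hgi
  -- The differences, shifted so that the killed state is `0`.
  let v : ℕ → ℝ → ℝ := fun k t => k.casesOn 0 fun k => u (k + 1) t - u k t
  have hv0 : ∀ t, v 0 t = 0 := fun _ => rfl
  have hvs : ∀ k t, v (k + 1) t = u (k + 1) t - u k t := fun _ _ => rfl
  have hvc : ∀ k, Continuous (v k) := by
    rintro (_ | k)
    · exact continuous_const
    · exact (huc (k + 1)).sub (huc k)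
  have hgen : ∀ k t, mm1Gen lam mu (fun j => u j t) k = lam * v (k + 1) t - mu * v k t := by
    rintro (_ | k) t <;> simp [mm1Gen, v]
  have hvd : ∀ k t, 0 < t → HasDerivAt (v (k + 1))
      ((lam * v (k + 2) t + mu * v k t) - (lam + mu) * v (k + 1) t) t := by
    intro k t ht
    refine ((hπ.hasDerivAt_meanAt hN hlam hmu hgi (k + 1) ht).sub
      (hπ.hasDerivAt_meanAt hN hlam hmu hgi k ht)).congr_deriv ?_
    rw [← hu, hgen, hgen]
    ring
  have hvz : ∀ k, |v (k + 1) 0| ≤ d := fun k => by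
    rw [hvs, hu, hN.meanAt_zero, hN.meanAt_zero]
    exact hg k
  set w : ℕ → ℝ := fun k => ∫ t in (0 : ℝ)..T, |v k t|
  have hub : ∀ k t, t ∈ Icc 0 T → |u k t| ≤ |g 0| + d * (k + lam * T) := fun k t ht =>
    (hπ.abs_meanAt_le_of_linear_growth hN hlam hlm hd (abs_le_of_lipschitz hg) k ht.1).trans
      (by gcongr; exact ht.2)
  -- The constant depends on `T` but only licenses the comparison; it does not enter the final
  -- bound.
  have hwC : ∀ k : ℕ, w k ≤ (T * (2 * (|g 0| + d * (lam * T + 1)))) * (k + 1) := by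
    intro k
    have hb : ∀ t ∈ Icc 0 T, |v k t| ≤ 2 * (|g 0| + d * (lam * T + 1)) * (k + 1) := by
      intro t ht
      rcases k with _ | k
      · rw [hv0, abs_zero]; positivity
      · have h1 := hub (k + 1) t ht
        have h2 := hub k t ht
        have h3 := abs_sub (u (k + 1) t) (u k t)
        rw [hvs]
        push_cast at h1 ⊢
        have h4 : 0 ≤ |g 0| * (k + 1) := by positivity
        have h5 : 0 ≤ d * (lam * T) * (k + 1) := by positivity
        nlinarith
    have h := intervalIntegral.integral_mono_on hT ((hvc k).abs.intervalIntegrable _ _)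
      (intervalIntegrable_const (μ := volume)) hb
    rw [intervalIntegral.integral_const, smul_eq_mul, sub_zero] at h
    exact h.trans (le_of_eq (by ring))
  -- Each difference is damped at rate `lam + mu` and driven by its two neighbours.
  have hsub : ∀ k, (lam + mu) * w (k + 1) ≤ d + lam * w (k + 2) + mu * w k := by
    intro k
    have hq : Continuous fun t => lam * |v (k + 2) t| + mu * |v k t| := by
      have := hvc (k + 2)
      have := hvc k
      fun_prop
    have h := mul_integral_abs_le (hvc (k + 1))
      (((hvc (k + 2)).const_mul lam).add ((hvc k).const_mul mu)) hq
      (fun t => (abs_add_le _ _).trans (le_of_eq (by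
        rw [abs_mul, abs_mul, abs_of_pos hlam, abs_of_pos hmu])))
      (hvd k) (by positivity) hT
    have hi : ∀ j a, IntervalIntegrable (fun t => a * |v j t|) volume 0 T := fun j a =>
      ((hvc j).abs.const_mul a).intervalIntegrable _ _
    have hsplit : ∫ t in (0 : ℝ)..T, (lam * |v (k + 2) t| + mu * |v k t|) =
        lam * w (k + 2) + mu * w k := by
      rw [← intervalIntegral.integral_const_mul, ← intervalIntegral.integral_const_mul]
      exact intervalIntegral.integral_add (hi (k + 2) lam) (hi k mu)
    rw [hsplit] at h
    exact h.trans (by linarith [hvz k])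
  have h := le_of_subsolution hlam hlm hd (w := w) (by simp [w, hv0])
    (fun k => intervalIntegral.integral_nonneg hT fun t _ => abs_nonneg _) hwC hsub (k + 1)
  push_cast at h
  exact h

lemma IsStationaryLaw.integrableOn_meanAt_succ_sub (hπ : IsStationaryLaw P N π)
    (hN : IsMM1Family lam mu P N) (hlam : 0 < lam) (hlm : lam < mu)
    (hg : ∀ k, |g (k + 1) - g k| ≤ d) (k : ℕ) :
    IntegrableOn (fun t => meanAt P N g (k + 1) t - meanAt P N g k t) (Ioi 0) ∧
      ∫ t in Ioi (0 : ℝ), |meanAt P N g (k + 1) t - meanAt P N g k t| ≤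
        d * (k + 1) / (mu - lam) := by
  have hc := hπ.continuous_meanAt hN hlam (hlam.trans hlm)
    (hπ.integrable_of_lipschitz hN hlam hlm hg)
  exact integrableOn_Ioi_of_integral_abs_le ((hc (k + 1)).sub (hc k)) fun T hT =>
    hπ.integral_abs_meanAt_succ_sub_le hN hlam hlm hg k hT

/-- Telescoping over the states below `k`. Quadratic growth suffices, since the stationary law has a
second moment. -/
lemma IsStationaryLaw.integrableOn_meanAt_sub_zero (hπ : IsStationaryLaw P N π)
    (hN : IsMM1Family lam mu P N) (hlam : 0 < lam) (hlm : lam < mu)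
    (hg : ∀ k, |g (k + 1) - g k| ≤ d) (k : ℕ) :
    IntegrableOn (fun t => meanAt P N g k t - meanAt P N g 0 t) (Ioi 0) ∧
      ∫ t in Ioi (0 : ℝ), |meanAt P N g k t - meanAt P N g 0 t| ≤
        d / (mu - lam) * (k : ℝ) ^ 2 := by
  have hml : 0 < mu - lam := sub_pos.2 hlm
  have hd : 0 ≤ d := (abs_nonneg _).trans (hg 0)
  induction k with
  | zero => simp
  | succ k ih =>
    obtain ⟨h1, h2⟩ := hπ.integrableOn_meanAt_succ_sub hN hlam hlm hg k
    have hadd : ∀ t, meanAt P N g (k + 1) t - meanAt P N g 0 t =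
        (meanAt P N g (k + 1) t - meanAt P N g k t) +
          (meanAt P N g k t - meanAt P N g 0 t) := fun t => by ring
    have h3 : IntegrableOn (fun t => meanAt P N g (k + 1) t - meanAt P N g 0 t) (Ioi 0) := by
      simp_rw [hadd]
      exact h1.add ih.1
    refine ⟨h3, ?_⟩
    have h4 := integral_mono h3.abs (h1.abs.add ih.1.abs) fun t => by
      simp only [Pi.add_apply]
      rw [hadd t]
      exact abs_add_le _ _
    simp only [Pi.add_apply] at h4
    rw [integral_add h1.abs ih.1.abs] at h4
    have h5 : d * (k + 1) / (mu - lam) + d / (mu - lam) * (k : ℝ) ^ 2 ≤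
        d / (mu - lam) * ((k + 1 : ℕ) : ℝ) ^ 2 := by
      have : 0 ≤ d / (mu - lam) * k := by positivity
      push_cast
      linear_combination this
    linarith [ih.2]

/-- By stationarity the centred mean from `k` is its difference to the mean from `0`, minus the
stationary average of such differences; Fubini handles the average. -/
lemma IsStationaryLaw.integrableOn_meanAt_sub_integral (hπ : IsStationaryLaw P N π)
    (hN : IsMM1Family lam mu P N) (hlam : 0 < lam) (hlm : lam < mu)
    (hg : ∀ k, |g (k + 1) - g k| ≤ d) (k : ℕ) :
    IntegrableOn (fun t => meanAt P N g k t - ∫ j, g j ∂π) (Ioi 0) := by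
  have := hπ.isProbabilityMeasure
  have hmu := hlam.trans hlm
  have hgi := hπ.integrable_of_lipschitz hN hlam hlm hg
  have hdiff := hπ.integrableOn_meanAt_sub_zero hN hlam hlm hg
  have hmeas : Measurable fun p : ℝ × ℕ => meanAt P N g p.2 p.1 - meanAt P N g 0 p.1 :=
    measurable_from_prod_countable_left fun j =>
      (hN.measurable_meanAt g j).sub (hN.measurable_meanAt g 0)
  have hprod : Integrable (fun p : ℝ × ℕ => meanAt P N g p.2 p.1 - meanAt P N g 0 p.1)
      ((volume.restrict (Ioi 0)).prod π) := by
    refine (integrable_prod_iff' hmeas.aestronglyMeasurable).2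
      ⟨ae_of_all _ fun j => (hdiff j).1, ?_⟩
    refine ((hπ.integrable_pow hN hlam hlm 2).const_mul (d / (mu - lam))).mono'
      measurable_from_top.aestronglyMeasurable (ae_of_all _ fun j => ?_)
    rw [Real.norm_of_nonneg (integral_nonneg fun t => norm_nonneg _)]
    exact (hdiff j).2
  have h1 : IntegrableOn (fun t => ∫ j, (meanAt P N g j t - meanAt P N g 0 t) ∂π) (Ioi 0) :=
    hprod.integral_prod_left
  refine ((hdiff k).1.sub h1).congr (ae_of_all _ fun t => ?_)
  have hi : Integrable (fun j => meanAt P N g j t) π := by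
    have hg' : Integrable g (π.bind (mm1Kernel P N t)) := by rwa [hπ.bind_eq hN]
    rw [Measure.comp_eq_comp_const_apply] at hg'
    have := hg'.integral_comp
    rw [Kernel.const_apply] at this
    simpa only [mm1Kernel_apply, hN.integral_mm1Law] using this
  simp only [Pi.sub_apply]
  rw [integral_sub hi (integrable_const _), hπ.integral_meanAt hN hgi]
  simp

end Lipschitz

/-! ### The Poisson equation -/

/-- Integrals over the windows `[T, T + 1]` tend both to `0` and to `c`. -/
lemma eq_zero_of_tendsto_of_tendsto_integral {f : ℝ → ℝ} (hf : Continuous f) {c l : ℝ}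
    (hc : Tendsto f atTop (𝓝 c))
    (hl : Tendsto (fun T => ∫ t in (0 : ℝ)..T, f t) atTop (𝓝 l)) : c = 0 := by
  have hi : ∀ a b, IntervalIntegrable f volume a b := fun a b => hf.intervalIntegrable a b
  have h1 : Tendsto (fun T : ℝ => ∫ t in T..T + 1, f t) atTop (𝓝 0) := by
    have := (hl.comp (tendsto_atTop_add_const_right atTop (1 : ℝ) tendsto_id)).sub hl
    rw [sub_self] at this
    exact this.congr fun T => intervalIntegral.integral_interval_sub_left (hi _ _) (hi _ _)
  have h2 : Tendsto (fun T : ℝ => ∫ t in T..T + 1, f t) atTop (𝓝 c) := by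
    rw [Metric.tendsto_nhds]
    intro ε hε
    obtain ⟨T₀, hT₀⟩ := eventually_atTop.1 (Metric.tendsto_nhds.1 hc (ε / 2) (half_pos hε))
    filter_upwards [eventually_ge_atTop T₀] with T hT
    have h3 : ∫ t in T..T + 1, (f t - c) = (∫ t in T..T + 1, f t) - c := by
      rw [intervalIntegral.integral_sub (hi _ _) intervalIntegrable_const]
      simp
    rw [Real.dist_eq, ← h3]
    have h4 := intervalIntegral.norm_integral_le_of_norm_le_const (a := T) (b := T + 1)
      (f := fun t => f t - c) (C := ε / 2) fun t ht => by
        rw [uIoc_of_le (by linarith)] at ht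
        exact (hT₀ t (hT.trans ht.1.le)).le
    rw [Real.norm_eq_abs, add_sub_cancel_left, abs_one, mul_one] at h4
    linarith
  exact tendsto_nhds_unique h2 h1

section Poisson

variable {Ω : Type*} [MeasurableSpace Ω] {lam mu δ : ℝ} {P : ℕ → Measure Ω} {N : ℝ≥0 → Ω → ℕ}
  {π : Measure ℕ}

/-- Limits of the time integrals of the centred means solve the Poisson equation. -/
lemma IsStationaryLaw.mm1Gen_eq_of_tendsto (hπ : IsStationaryLaw P N π)
    (hN : IsMM1Family lam mu P N) (hlam : 0 < lam) (hmu : 0 < mu) {g l : ℕ → ℝ}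
    (hg : Integrable g π)
    (hl : ∀ k, Tendsto (fun T => ∫ t in (0 : ℝ)..T, (meanAt P N g k t - ∫ j, g j ∂π)) atTop
      (𝓝 (l k))) (k : ℕ) :
    mm1Gen lam mu l k = ∫ j, g j ∂π - g k := by
  set m := ∫ j, g j ∂π
  have hc := hπ.continuous_meanAt hN hlam hmu hg
  have hi : ∀ k T, IntervalIntegrable (fun t => meanAt P N g k t - m) volume 0 T := fun k T =>
    ((hc k).sub continuous_const).intervalIntegrable _ _
  have hS : ∀ T, 0 ≤ T →
      mm1Gen lam mu (fun k => ∫ t in (0 : ℝ)..T, (meanAt P N g k t - m)) k =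
        meanAt P N g k T - g k := by
    intro T hT
    rw [hπ.meanAt_backward hN hlam hmu hg k hT, add_sub_cancel_left]
    simp only [mm1Gen]
    by_cases hk : 0 < k
    · simp only [hk, if_true]
      rw [← intervalIntegral.integral_sub (hi _ _) (hi _ _),
        ← intervalIntegral.integral_sub (hi _ _) (hi _ _),
        ← intervalIntegral.integral_const_mul, ← intervalIntegral.integral_const_mul,
        ← intervalIntegral.integral_sub (((hi _ _).sub (hi _ _)).const_mul _)
          (((hi _ _).sub (hi _ _)).const_mul _)]
      exact intervalIntegral.integral_congr fun t _ => by ring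
    · simp only [hk, if_false]
      rw [← intervalIntegral.integral_sub (hi _ _) (hi _ _), sub_zero,
        ← intervalIntegral.integral_const_mul]
      exact intervalIntegral.integral_congr fun t _ => by ring
  -- Convergence of the integrals alone makes the mean at time `T` converge, and then forces its
  -- limit to be `m`; no ergodic theorem is needed.
  have h1 : Tendsto (fun T => meanAt P N g k T - g k) atTop (𝓝 (mm1Gen lam mu l k)) :=
    (tendsto_mm1Gen hl k).congr' ((eventually_ge_atTop 0).mono hS)
  have h2 : Tendsto (fun T => meanAt P N g k T - m) atTop
      (𝓝 (mm1Gen lam mu l k + (g k - m))) :=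
    (h1.add_const (g k - m)).congr fun T => by ring
  have := eq_zero_of_tendsto_of_tendsto_integral ((hc k).sub continuous_const) h2 (hl k)
  linarith

lemma expAt_eq_meanAt (h : ℝ → ℝ) (k : ℕ) (t : ℝ) :
    expAt δ P N h k t = meanAt P N (fun j => h (δ * j)) k t := rfl

lemma fwdDiff_iter_grid (δ : ℝ) (h : ℝ → ℝ) (a k : ℕ) :
    (Δ_[δ])^[a] h (δ * k) = (Δ_[1])^[a] (fun j : ℕ => h (δ * j)) k := by
  induction a generalizing k with
  | zero => rfl
  | succ a ih =>
    have hk : δ * (k : ℝ) + δ = δ * ((k + 1 : ℕ) : ℝ) := by push_cast; ring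
    rw [Function.iterate_succ_apply', Function.iterate_succ_apply', fwdDiff, fwdDiff, hk, ih, ih]

lemma fwdDiff_one_grid (δ : ℝ) (h : ℝ → ℝ) (k : ℕ) :
    Δ_[δ] h (δ * k) = h (δ * (k + 1 : ℕ)) - h (δ * k) := by
  have := fwdDiff_iter_grid δ h 1 k
  simpa [fwdDiff] using this

/-- Bounded inhomogeneities of the differenced Poisson equation have bounded solutions of linear
growth. -/
lemma abs_le_of_linear_recursion {C M : ℝ} (hlam : 0 < lam) (hlm : lam < mu) {e b : ℕ → ℝ}
    (he : ∀ k, mu * e k = lam * e (k + 1) + b k) (hb : ∀ k, |b k| ≤ M)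
    (hC : ∀ k : ℕ, |e k| ≤ C * (k + 1)) (k : ℕ) : |e k| ≤ M / (mu - lam) := by
  have hmu := hlam.trans hlm
  have hml : 0 < mu - lam := sub_pos.2 hlm
  have hM : 0 ≤ M := (abs_nonneg _).trans (hb 0)
  have hm : (mu - lam) * (M / (mu - lam)) = M := by field_simp
  have hm0 : 0 ≤ M / (mu - lam) := by positivity
  -- `M / (mu - lam)` is the fixed point of `mu * x = lam * x + M`.
  refine sub_nonpos.1 (nonpos_of_linear_growth (e := fun k => |e k| - M / (mu - lam))
    hlam hlm (fun k => ?_) (fun k => (sub_le_self _ hm0).trans (hC k)) k)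
  have h1 : mu * |e k| ≤ lam * |e (k + 1)| + |b k| := by
    calc mu * |e k| = |lam * e (k + 1) + b k| := by rw [← he k, abs_mul, abs_of_pos hmu]
      _ ≤ |lam * e (k + 1)| + |b k| := abs_add_le _ _
      _ = _ := by rw [abs_mul, abs_of_pos hlam]
  have := hb k
  linarith

end Poisson

/-! ### Bounds on the differences of the Poisson solution. -/

section SteinFactors

variable {Ω : Type*} [MeasurableSpace Ω] {lam mu δ : ℝ} {P : ℕ → Measure Ω} {N : ℝ≥0 → Ω → ℕ}
  {π : Measure ℕ} {h : ℝ → ℝ}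

lemma DLip.abs_sub_le (hh : DLip δ h) (k : ℕ) :
    |h (δ * ((k + 1 : ℕ) : ℝ)) - h (δ * (k : ℝ))| ≤ δ := by
  rw [← fwdDiff_one_grid]
  exact hh k

lemma DLip.tendsto_partialSol (hh : DLip δ h) (hπ : IsStationaryLaw P N π)
    (hN : IsMM1Family lam mu P N) (hlam : 0 < lam) (hlm : lam < mu) (k : ℕ) :
    Tendsto (partialSol δ P N π h k) atTop
      (𝓝 (∫ t in Ioi (0 : ℝ), (expAt δ P N h k t - statExp δ π h))) :=
  intervalIntegral_tendsto_integral_Ioi 0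
    (hπ.integrableOn_meanAt_sub_integral hN hlam hlm (g := fun j => h (δ * j))
      hh.abs_sub_le k) tendsto_id

lemma DLip.abs_poissonSol_succ_sub_le (hh : DLip δ h) (hπ : IsStationaryLaw P N π)
    (hN : IsMM1Family lam mu P N) (hlam : 0 < lam) (hlm : lam < mu) (k : ℕ) :
    |poissonSol δ P N π h (k + 1) - poissonSol δ P N π h k| ≤ δ * (k + 1) / (mu - lam) := by
  have hi := hπ.integrableOn_meanAt_sub_integral hN hlam hlm (g := fun j => h (δ * j))
      hh.abs_sub_le
  have h1 : poissonSol δ P N π h (k + 1) - poissonSol δ P N π h k =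
      ∫ t in Ioi (0 : ℝ), (expAt δ P N h (k + 1) t - expAt δ P N h k t) := by
    rw [poissonSol, poissonSol, (hh.tendsto_partialSol hπ hN hlam hlm (k + 1)).limUnder_eq,
      (hh.tendsto_partialSol hπ hN hlam hlm k).limUnder_eq]
    refine (integral_sub (hi (k + 1)) (hi k)).symm.trans ?_
    congr 1 with t
    rw [expAt_eq_meanAt, expAt_eq_meanAt]
    ring
  rw [h1]
  exact (abs_integral_le_integral_abs).trans
    (hπ.integrableOn_meanAt_succ_sub hN hlam hlm (g := fun j => h (δ * j))
      hh.abs_sub_le k).2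

/-- The Poisson equation for `poissonSol`. -/
lemma IsStationaryLaw.mm1Gen_poissonSol (hπ : IsStationaryLaw P N π)
    (hN : IsMM1Family lam mu P N) (hlam : 0 < lam) (hmu : 0 < mu)
    (hi : Integrable (fun j : ℕ => h (δ * (j : ℝ))) π)
    (hl : ∀ k : ℕ, ∃ l : ℝ, Tendsto (partialSol δ P N π h k) atTop (𝓝 l)) (k : ℕ) :
    mm1Gen lam mu (poissonSol δ P N π h) k = statExp δ π h - h (δ * k) :=
  hπ.mm1Gen_eq_of_tendsto hN hlam hmu hi (fun k => tendsto_nhds_limUnder (hl k)) k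

/-- The Poisson equation as a recursion for the differences of `poissonSol`. -/
lemma IsStationaryLaw.poissonSol_recursion (hπ : IsStationaryLaw P N π)
    (hN : IsMM1Family lam mu P N) (hlam : 0 < lam) (hmu : 0 < mu)
    (hi : Integrable (fun j : ℕ => h (δ * (j : ℝ))) π)
    (hl : ∀ k : ℕ, ∃ l : ℝ, Tendsto (partialSol δ P N π h k) atTop (𝓝 l)) (k : ℕ) :
    mu * Δ_[1] (poissonSol δ P N π h) k =
      lam * Δ_[1] (poissonSol δ P N π h) (k + 1) + (h (δ * (k + 1 : ℕ)) - statExp δ π h) := by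
  have := hπ.mm1Gen_poissonSol hN hlam hmu hi hl (k + 1)
  simp only [mm1Gen, Nat.succ_pos, if_true, Nat.add_sub_cancel] at this
  simp only [fwdDiff]
  linarith

/-- Differencing the recursion once removes the stationary mean and leaves a first difference of
`h`; the first-order bound supplies the required linear growth. -/
lemma DLip.abs_fwdDiff_two_poissonSol_le (hh : DLip δ h) (hπ : IsStationaryLaw P N π)
    (hN : IsMM1Family lam mu P N) (hlam : 0 < lam) (hlm : lam < mu) (k : ℕ) :
    |(Δ_[1])^[2] (poissonSol δ P N π h) k| ≤ δ / (mu - lam) := by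
  have hml : 0 < mu - lam := sub_pos.2 hlm
  have hδ : 0 ≤ δ := (abs_nonneg _).trans (hh 0)
  have hrec := hπ.poissonSol_recursion hN hlam (hlam.trans hlm)
    (hπ.integrable_of_lipschitz hN hlam hlm (g := fun j => h (δ * j))
      hh.abs_sub_le)
    fun k => ⟨_, hh.tendsto_partialSol hπ hN hlam hlm k⟩
  refine abs_le_of_linear_recursion (C := 3 * (δ / (mu - lam))) hlam hlm
    (b := fun k => h (δ * (k + 1 + 1 : ℕ)) - h (δ * (k + 1 : ℕ)))
    (fun k => ?_) (fun k => hh.abs_sub_le (k + 1)) (fun k => ?_) k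
  · have h1 := hrec k
    have h2 := hrec (k + 1)
    simp only [Function.iterate_succ_apply', Function.iterate_zero, id, fwdDiff] at h1 h2 ⊢
    linarith
  · have h1 := hh.abs_poissonSol_succ_sub_le hπ hN hlam hlm k
    have h2 := hh.abs_poissonSol_succ_sub_le hπ hN hlam hlm (k + 1)
    simp only [Function.iterate_succ_apply', Function.iterate_zero, id, fwdDiff]
    refine (abs_sub _ _).trans ((add_le_add h2 h1).trans ?_)
    have h3 : 0 ≤ δ / (mu - lam) * k := by positivity
    push_cast
    linear_combination h3

/-- The recursion differenced twice, with growth controlled by the second-order bound. -/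
lemma DLip.abs_fwdDiff_three_poissonSol_le (hh : DLip δ h) (hπ : IsStationaryLaw P N π)
    (hN : IsMM1Family lam mu P N) (hlam : 0 < lam) (hlm : lam < mu) {M : ℝ}
    (h2 : ∀ k : ℕ, |(Δ_[δ])^[2] h (δ * (k : ℝ))| ≤ M) (k : ℕ) :
    |(Δ_[1])^[3] (poissonSol δ P N π h) k| ≤ M / (mu - lam) := by
  have hml : 0 < mu - lam := sub_pos.2 hlm
  have hδ : 0 ≤ δ := (abs_nonneg _).trans (hh 0)
  have hrec := hπ.poissonSol_recursion hN hlam (hlam.trans hlm)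
    (hπ.integrable_of_lipschitz hN hlam hlm (g := fun j => h (δ * j))
      hh.abs_sub_le)
    fun k => ⟨_, hh.tendsto_partialSol hπ hN hlam hlm k⟩
  refine abs_le_of_linear_recursion (C := 2 * (δ / (mu - lam))) hlam hlm
    (b := fun k => (Δ_[δ])^[2] h (δ * (k + 1 : ℕ)))
    (fun k => ?_) (fun k => h2 (k + 1)) (fun k => ?_) k
  · have h1 := hrec k
    have h2 := hrec (k + 1)
    have h3 := hrec (k + 2)
    simp only [fwdDiff_iter_grid, Function.iterate_succ_apply', Function.iterate_zero, id,
      fwdDiff] at h1 h2 h3 ⊢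
    linarith
  · have h1 := hh.abs_fwdDiff_two_poissonSol_le hπ hN hlam hlm
    rw [Function.iterate_succ_apply', fwdDiff]
    refine (abs_sub _ _).trans ((add_le_add (h1 _) (h1 _)).trans ?_)
    have h3 : 0 ≤ δ / (mu - lam) * k := by positivity
    linear_combination 2 * h3

end SteinFactors

theorem mainTheorem6 {Ω : Type*} [MeasurableSpace Ω] (lam mu δ : ℝ)
    (hlam : 0 < lam) (hlm : lam < mu) (hδ : 0 < δ)
    (P : ℕ → Measure Ω) (N : ℝ≥0 → Ω → ℕ) (hN : IsMM1Family lam mu P N)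
    (π : Measure ℕ) (hπ : IsStationaryLaw P N π) :
    -- for `h` in `dLip(1)` everything is well defined and the integrated difference is bounded
    (∀ h : ℝ → ℝ, DLip δ h →
      (∀ (k : ℕ) (t : ℝ≥0), Integrable (fun ω => h (δ * (N t ω : ℝ))) (P k)) ∧
      Integrable (fun j : ℕ => h (δ * (j : ℝ))) π ∧
      (∀ k : ℕ, IntegrableOn (fun t : ℝ => expAt δ P N h k t - statExp δ π h) (Ioi 0)) ∧
      (∀ k : ℕ,
        IntegrableOn (fun t : ℝ => expAt δ P N h (k + 1) t - expAt δ P N h k t) (Ioi 0) ∧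
        ∫ t in Ioi (0 : ℝ), |expAt δ P N h (k + 1) t - expAt δ P N h k t|
          ≤ δ * ((k : ℝ) + 1) / (mu - lam))) ∧
    -- the Stein factor bounds of orders one, two and three
    (∀ (h : ℝ → ℝ) (a : ℕ), 1 ≤ a → a ≤ 3 →
      (∀ v : ℕ, 1 ≤ v → v ≤ a → ∀ k : ℕ, |(Δ_[δ])^[v] h (δ * (k : ℝ))| ≤ δ ^ v) →
      ∀ k : ℕ, |(Δ_[1])^[a] (poissonSol δ P N π h) k|
        ≤ δ ^ a * ((k : ℝ) + 1) / (mu - lam) + δ ^ (a - 1) * (1 / (mu - lam))) ∧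
    -- the identity at zero, for every `h` for which `f_h` is well defined
    (∀ h : ℝ → ℝ, Integrable (fun j : ℕ => h (δ * (j : ℝ))) π →
      (∀ k : ℕ, ∃ l : ℝ, Tendsto (partialSol δ P N π h k) atTop (𝓝 l)) →
      (Δ_[1])^[2] (poissonSol δ P N π h) 0 - Δ_[1] (poissonSol δ P N π h) 0
        = (lam + mu) / mu * (Δ_[1])^[3] (poissonSol δ P N π h) 0
          - 1 / mu * (Δ_[δ])^[3] h 0
          - lam / mu * (Δ_[1])^[3] (poissonSol δ P N π h) 1) := by

  have hmu := hlam.trans hlm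
  have hml : 0 < mu - lam := sub_pos.2 hlm
  refine ⟨fun h hh => ⟨fun k t => ?_, ?_, fun k => ?_, fun k => ?_⟩, fun h a ha1 ha3 hv k => ?_,
    fun h hi hl => ?_⟩
  · exact hπ.integrable hN hlam hmu (hπ.integrable_of_lipschitz hN hlam hlm (g := fun j => h (δ * j))
      hh.abs_sub_le) k t
  · exact hπ.integrable_of_lipschitz hN hlam hlm (g := fun j => h (δ * j))
      hh.abs_sub_le
  · exact hπ.integrableOn_meanAt_sub_integral hN hlam hlm (g := fun j => h (δ * j))
      hh.abs_sub_le k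
  · exact hπ.integrableOn_meanAt_succ_sub hN hlam hlm (g := fun j => h (δ * j))
      hh.abs_sub_le k
  · have hh : DLip δ h := fun k => by simpa using hv 1 le_rfl ha1 k
    -- Orders two and three obey bounds uniform in `k`, equal to the second summand; order one is
    -- bounded by the first summand. The other summand is slack.
    have hp : ∀ b : ℕ, 0 ≤ δ ^ b * ((k : ℝ) + 1) / (mu - lam) := fun b => by positivity
    interval_cases a
    · have h1 := hh.abs_poissonSol_succ_sub_le hπ hN hlam hlm k
      have h2 : 0 ≤ δ ^ (1 - 1) * (1 / (mu - lam)) := by positivity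
      simp only [Function.iterate_one, fwdDiff]
      rw [pow_one]
      linarith
    · have h1 := hh.abs_fwdDiff_two_poissonSol_le hπ hN hlam hlm k
      have h2 : δ ^ (2 - 1) * (1 / (mu - lam)) = δ / (mu - lam) := by norm_num; ring
      rw [h2]
      linarith [hp 2]
    · have h1 := hh.abs_fwdDiff_three_poissonSol_le hπ hN hlam hlm
        (hv 2 one_le_two (by norm_num)) k
      have h2 : δ ^ (3 - 1) * (1 / (mu - lam)) = δ ^ 2 / (mu - lam) := by norm_num; ring
      rw [h2]
      linarith [hp 3]
  -- With the convention `Δ f_h (-δ) = 0`, the equation `h0` is the recursion at `-1`. The identity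
  -- is the third difference of the recursion over `-1, 0, 1, 2`.
  · have h0 := hπ.mm1Gen_poissonSol hN hlam hmu hi hl 0
    have h1 := hπ.poissonSol_recursion hN hlam hmu hi hl 0
    have h2 := hπ.poissonSol_recursion hN hlam hmu hi hl 1
    have h3 := hπ.poissonSol_recursion hN hlam hmu hi hl 2
    have hg := fwdDiff_iter_grid δ h 3 0
    rw [Nat.cast_zero, mul_zero] at hg
    rw [hg]
    simp only [Function.iterate_succ_apply', Function.iterate_zero, id, fwdDiff, mm1Gen,
      lt_irrefl, if_false, sub_zero] at h0 h1 h2 h3 ⊢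
    field_simp
    norm_num at h0 h1 h2 h3 ⊢
    linarith
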